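/- Let $H^U$ be the Hilbert space of absolutely continuous $h:\mathbb R\to\mathbb R$ with $\|h\|_{H^U}^2=\int_{\mathbb R}\bigl(\tfrac14h(t)^2+\dot h(t)^2\bigr)\,dt<\infty$. Let $\mathcal U\supset H^U$ be the Banach space of continuous $\omega:\mathbb R\to\mathbb R$ with $\lim_{|t|\to\infty}|\omega(t)|/\log|t|=0$ and norm $\|\omega\|_{\mathcal U}=\sup_t|\omega(t)|/\log(e+|t|)$. Let $\mathcal W_{H^U}$ be the Borel probability measure on $\mathcal U$ that is the law of the stationary Ornstein–Uhlenbeck process $t\mapsto e^{-t/2}B(e^t)$, where $B$ is a standard Brownian motion on $[0,\infty)$. Every $\omega\in\mathcal U$ defines the tempered distribution $\varphi\mapsto\int_{\mathbb R}\varphi(t)\omega(t)\,dt$; a tempered distribution is represented by $\omega$ if it equals this one. For $u\in\mathbb R$ let $\mu^{*u}$ be the tempered distribution on $\mathbb R$ with Fourier transform $\widehat{\mu^{*u}}(\lambda)=e^{-2iu\arctan(2\lambda)}$, where $\widehat\varphi(\lambda)=\int e^{-i\lambda t}\varphi(t)\,dt$. For a Schwartz function $\varphi$, $\varphi*\mu^{*u}$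 is the Schwartz function with Fourier transform $\widehat\varphi(\lambda)e^{-2iu\arctan(2\lambda)}$; for a tempered distribution $T$, $T*\mu^{*u}$ is the tempered distribution with $\langle\varphi,T*\mu^{*u}\rangle=\langle\varphi*\mu^{*(-u)},T\rangle$. Let $\mathcal S^u$ be the orthogonal transformation of $H^U$ that extends $\varphi\mapsto\varphi*\mu^{*u}$ from real Schwartz functions. For $x\in\mathcal U^*$ let $h_x\in H^U$ be given by $(h,h_x)_{H^U}=\langle h,x\rangle$ for all $h\in H^U$, and let $\mathcal I:H^U\to L^2(\mathcal W_{H^U})$ be the Paley–Wiener map, the isometry with $\mathcal I(h_x)=\langle\,\cdot\,,x\rangle$ for all $x\in\mathcal U^*$. Let $S^u:\mathcal U\to\mathcal U$ be the $\mathcal W_{H^U}$-almost surely unique measurable map such that, for every $h\in H^U$, $\mathcal I(h)\circ S^u=\mathcal I\bigl((\mathcal S^u)^\top h\bigr)$ $\mathcal W_{H^U}$-almost surely. Then, for every $u\in\mathbb R$: a map $S^u$ with this property exists and, for $\mathcal W_{H^U}$-almost every $\omega\in\mathcal U$, the tempered distribution $\omega*\mu^{*u}$ is represented by an element of $\mathcal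 U$, and that element is $S^u\omega$. -/

import Mathlib

open Filter Topology MeasureTheory
open scoped SchwartzMap FourierTransform NNReal ENNReal ZeroAtInfty

noncomputable section

namespace OUFlow

/-! ### The path space `𝒰` -/

/-- The vector space of continuous `ω : ℝ → ℝ` with `|ω(t)| / log |t| → 0` as `|t| → ∞`. -/
def pathSubmodule : Submodule ℝ (ℝ → ℝ) where
  carrier := {ω | Continuous ω ∧ Tendsto (fun t => |ω t| / Real.log |t|) (cocompact ℝ) (𝓝 0)}
  zero_mem' := ⟨continuous_const, by simp⟩
  add_mem' := by
    rintro f g ⟨hf, hf'⟩ ⟨hg, hg'⟩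
    refine ⟨hf.add hg, ?_⟩
    have h := hf'.add hg'
    rw [add_zero] at h
    refine squeeze_zero_norm' ?_ h
    filter_upwards [(tendsto_norm_cocompact_atTop (E := ℝ)).eventually_ge_atTop 1] with t ht
    have hl : 0 ≤ Real.log |t| := Real.log_nonneg ht
    rw [Real.norm_of_nonneg (by positivity), ← add_div]
    gcongr
    exact abs_add_le _ _
  smul_mem' := by
    rintro c f ⟨hf, hf'⟩
    refine ⟨hf.const_smul c, ?_⟩
    have h := hf'.const_mul |c|
    rw [mul_zero] at h
    refine h.congr fun t => ?_
    simp [abs_mul, mul_div_assoc]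

/-- The Banach space `𝒰` of continuous `ω : ℝ → ℝ` with `|ω(t)| / log |t| → 0` as `|t| → ∞`.
It is a type of its own, so that it carries the weighted supremum norm (see `PathSpace.norm_eq`)
and not the topology of pointwise convergence. -/
def PathSpace : Type := pathSubmodule

namespace PathSpace

instance : AddCommGroup PathSpace := inferInstanceAs (AddCommGroup pathSubmodule)
instance : Module ℝ PathSpace := inferInstanceAs (Module ℝ pathSubmodule)
instance : FunLike PathSpace ℝ ℝ where
  coe ω := ω.1
  coe_injective := Subtype.val_injective

theorem continuous (ω : PathSpace) : Continuous ω := ω.2.1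

theorem tendsto (ω : PathSpace) :
    Tendsto (fun t => |ω t| / Real.log |t|) (cocompact ℝ) (𝓝 0) := ω.2.2

/-- The weight `log (e + |t|)`. -/
def weight (t : ℝ) : ℝ := Real.log (Real.exp 1 + |t|)

theorem one_le_weight (t : ℝ) : 1 ≤ weight t := by
  rw [weight, Real.le_log_iff_exp_le (by positivity)]
  simp

theorem weight_pos (t : ℝ) : 0 < weight t := one_pos.trans_le (one_le_weight t)

theorem continuous_weight : Continuous weight := by
  unfold weight
  exact Continuous.log (by fun_prop) fun t => by positivity

theorem log_abs_le_weight {t : ℝ} (ht : 1 ≤ |t|) : Real.log |t| ≤ weight t :=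
  Real.log_le_log (by positivity) (by linarith [Real.exp_pos 1])

/-- The isometry `ω ↦ ω / log (e + |·|)` of `𝒰` into `C₀(ℝ)`. -/
def toC0 : PathSpace →ₗ[ℝ] C₀(ℝ, ℝ) where
  toFun ω :=
    { toFun := fun t => ω t / weight t
      continuous_toFun := ω.continuous.div continuous_weight fun t => (weight_pos t).ne'
      zero_at_infty' := by
        refine squeeze_zero_norm' ?_ ω.tendsto
        filter_upwards [(tendsto_norm_cocompact_atTop (E := ℝ)).eventually_gt_atTop 1] with t ht
        have hl : 0 < Real.log |t| := Real.log_pos ht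
        rw [Real.norm_eq_abs, abs_div, abs_of_pos (weight_pos t)]
        gcongr
        exact log_abs_le_weight (le_of_lt ht) }
  map_add' f g := by
    ext t
    exact add_div (f t) (g t) (weight t)
  map_smul' c f := by
    ext t
    exact mul_div_assoc c (f t) (weight t)

theorem toC0_apply (ω : PathSpace) (t : ℝ) : toC0 ω t = ω t / weight t := rfl

theorem toC0_injective : Function.Injective toC0 := by
  intro f g h
  refine DFunLike.ext _ _ fun t => ?_
  have := DFunLike.congr_fun h t
  rwa [toC0_apply, toC0_apply, div_left_inj' (weight_pos t).ne'] at this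

/-- The norm of `𝒰`; written out in `norm_eq`. -/
instance : NormedAddCommGroup PathSpace :=
  NormedAddCommGroup.induced PathSpace C₀(ℝ, ℝ) toC0 toC0_injective
instance : NormedSpace ℝ PathSpace := NormedSpace.induced ℝ PathSpace C₀(ℝ, ℝ) toC0
/-- The Borel σ-algebra of the norm topology. -/
instance : MeasurableSpace PathSpace := borel PathSpace
instance : BorelSpace PathSpace := ⟨rfl⟩

/-- The norm of `𝒰` is `sup_t |ω(t)| / log (e + |t|)`. -/
theorem norm_eq (ω : PathSpace) : ‖ω‖ = ⨆ t : ℝ, (Real.log (Real.exp 1 + |t|))⁻¹ * |ω t| := by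
  change ‖toC0 ω‖ = _
  rw [← ZeroAtInftyContinuousMap.norm_toBCF_eq_norm, BoundedContinuousFunction.norm_eq_iSup_norm]
  congr 1
  ext t
  change ‖ω t / weight t‖ = (weight t)⁻¹ * |ω t|
  rw [Real.norm_eq_abs, abs_div, abs_of_pos (weight_pos t), div_eq_inv_mul]

theorem abs_le (ω : PathSpace) (t : ℝ) : |ω t| ≤ ‖ω‖ * weight t := by
  have h : ‖toC0 ω t‖ ≤ ‖toC0 ω‖ := (toC0 ω).toBCF.norm_coe_le_norm t
  rw [toC0_apply, Real.norm_eq_abs, abs_div, abs_of_pos (weight_pos t),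
    div_le_iff₀ (weight_pos t)] at h
  exact h

theorem weight_le (t : ℝ) : weight t ≤ 3 + ‖t‖ := by
  have := Real.log_le_sub_one_of_pos (show 0 < Real.exp 1 + |t| by positivity)
  have h := Real.exp_one_lt_d9
  rw [Real.norm_eq_abs]
  unfold weight
  linarith

theorem norm_mul_le (ω : PathSpace) (φ : 𝓢(ℝ, ℂ)) (t : ℝ) :
    ‖φ t * (ω t : ℂ)‖ ≤ ‖ω‖ * (3 * (‖t‖ ^ 0 * ‖φ t‖) + ‖t‖ ^ 1 * ‖φ t‖) := by
  rw [norm_mul, Complex.norm_real, Real.norm_eq_abs (ω t)]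
  calc ‖φ t‖ * |ω t| ≤ ‖φ t‖ * (‖ω‖ * (3 + ‖t‖)) := by
        gcongr
        exact (ω.abs_le t).trans (by gcongr; exact weight_le t)
    _ = _ := by ring

theorem integrable_bound (ω : PathSpace) (φ : 𝓢(ℝ, ℂ)) :
    Integrable fun t : ℝ => ‖ω‖ * (3 * (‖t‖ ^ 0 * ‖φ t‖) + ‖t‖ ^ 1 * ‖φ t‖) :=
  (((φ.integrable_pow_mul volume 0).const_mul 3).add (φ.integrable_pow_mul volume 1)).const_mul _

theorem integrable_mul (ω : PathSpace) (φ : 𝓢(ℝ, ℂ)) :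
    Integrable fun t : ℝ => φ t * (ω t : ℂ) :=
  (ω.integrable_bound φ).mono'
    (φ.continuous.mul (Complex.continuous_ofReal.comp ω.continuous)).aestronglyMeasurable
    (Eventually.of_forall (ω.norm_mul_le φ))

theorem exists_bound (ω : PathSpace) : ∃ (s : Finset (ℕ × ℕ)) (C : ℝ), 0 ≤ C ∧
    ∀ φ : 𝓢(ℝ, ℂ), ‖∫ t : ℝ, φ t * (ω t : ℂ)‖ ≤ C * s.sup (schwartzSeminormFamily ℂ ℝ ℂ) φ := by
  set p := (volume : Measure ℝ).integrablePower with hp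
  set K : ℝ := 2 ^ p * ∫ x : ℝ, (1 + ‖x‖) ^ (-(p : ℝ)) with hK
  have hK0 : 0 ≤ K := by positivity
  refine ⟨Finset.Iic (1 + p, 0), ‖ω‖ * (3 * (K * 2) + K * 2), by positivity, fun φ => ?_⟩
  set S := (Finset.Iic (1 + p, 0)).sup (schwartzSeminormFamily ℂ ℝ ℂ) φ with hS
  have hle : ∀ k ≤ 1 + p, SchwartzMap.seminorm ℂ k 0 φ ≤ S := fun k hk =>
    Seminorm.le_def.1 (Finset.le_sup (f := schwartzSeminormFamily ℂ ℝ ℂ)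
      (show (k, 0) ∈ Finset.Iic (1 + p, 0) from Finset.mem_Iic.2 ⟨hk, le_rfl⟩)) φ
  have hb : ∀ k ≤ 1, ∫ t : ℝ, ‖t‖ ^ k * ‖φ t‖ ≤ K * 2 * S := by
    intro k hk
    have h := SchwartzMap.integral_pow_mul_iteratedFDeriv_le ℂ (volume : Measure ℝ) φ k 0
    simp only [norm_iteratedFDeriv_zero] at h
    refine h.trans ?_
    rw [mul_assoc K]
    refine mul_le_mul_of_nonneg_left ?_ hK0
    linarith [hle 0 (by omega), hle (k + p) (by omega)]
  refine (norm_integral_le_integral_norm _).trans ?_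
  refine (integral_mono (ω.integrable_mul φ).norm (ω.integrable_bound φ)
    (ω.norm_mul_le φ)).trans ?_
  rw [integral_const_mul, integral_add ((φ.integrable_pow_mul volume 0).const_mul 3)
    (φ.integrable_pow_mul volume 1), integral_const_mul, mul_assoc]
  refine mul_le_mul_of_nonneg_left ?_ (norm_nonneg ω)
  linarith [hb 0 (by omega), hb 1 le_rfl]

/-- The tempered distribution `φ ↦ ∫ φ(t) ω(t) dt` attached to a path `ω ∈ 𝒰`. -/
def toDistribution (ω : PathSpace) : 𝓢'(ℝ, ℂ) :=
  ContinuousLinearMap.toPointwiseConvergenceCLM ℂ (RingHom.id ℂ) 𝓢(ℝ, ℂ) ℂ <|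
    SchwartzMap.mkCLMtoNormedSpace (𝕜 := ℂ) (σ := RingHom.id ℂ)
      (fun φ : 𝓢(ℝ, ℂ) => ∫ t : ℝ, φ t * (ω t : ℂ))
      (fun φ ψ => by
        simp only [_root_.add_apply, add_mul]
        exact integral_add (ω.integrable_mul φ) (ω.integrable_mul ψ))
      (fun c φ => by
        simp only [_root_.smul_apply, smul_eq_mul, mul_assoc, RingHom.id_apply]
        exact integral_const_mul _ _)
      ω.exists_bound

theorem toDistribution_apply (ω : PathSpace) (φ : 𝓢(ℝ, ℂ)) :
    ω.toDistribution φ = ∫ t : ℝ, φ t * (ω t : ℂ) := rfl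

end PathSpace

/-! ### The Hilbert space `H^U` -/

theorem ac_differentiable {h : ℝ → ℝ} (hh : ∀ a b, AbsolutelyContinuousOnInterval h a b) :
    ∀ᵐ t : ℝ, DifferentiableAt ℝ h t := by
  have : ∀ᵐ t : ℝ, ∀ n : ℕ, t ∈ Set.uIcc (-n : ℝ) n → DifferentiableAt ℝ h t :=
    ae_all_iff.2 fun n => (hh _ _).ae_differentiableAt
  filter_upwards [this] with t ht
  obtain ⟨n, hn⟩ := exists_nat_ge |t|
  refine ht n ?_
  rw [Set.uIcc_of_le (by linarith [abs_nonneg t])]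
  exact abs_le.1 hn

theorem ac_continuous {h : ℝ → ℝ} (hh : ∀ a b, AbsolutelyContinuousOnInterval h a b) :
    Continuous h := by
  refine continuous_iff_continuousAt.2 fun t => ?_
  have := (hh (t - 1) (t + 1)).continuousOn
  rw [Set.uIcc_of_le (by linarith)] at this
  exact this.continuousAt (Icc_mem_nhds (by linarith) (by linarith))

theorem ac_deriv_add {f g : ℝ → ℝ} (hf : ∀ a b, AbsolutelyContinuousOnInterval f a b)
    (hg : ∀ a b, AbsolutelyContinuousOnInterval g a b) :
    deriv (f + g) =ᵐ[volume] deriv f + deriv g := by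
  filter_upwards [ac_differentiable hf, ac_differentiable hg] with t h1 h2
  exact deriv_add h1 h2

theorem deriv_smul_fun (c : ℝ) (f : ℝ → ℝ) : deriv (c • f) = c • deriv f := by
  ext t
  exact deriv_const_smul_field c f

/-- The vector space of absolutely continuous `h : ℝ → ℝ` with `∫ (h² / 4 + h'²) < ∞`. -/
def energySubmodule : Submodule ℝ (ℝ → ℝ) where
  carrier := {h | (∀ a b, AbsolutelyContinuousOnInterval h a b) ∧ MemLp h 2 ∧ MemLp (deriv h) 2}
  zero_mem' := by
    refine ⟨fun a b => ?_, MemLp.zero, ?_⟩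
    · exact (contDiff_const (n := 1)).contDiffOn.absolutelyContinuousOnInterval
    · have : deriv (0 : ℝ → ℝ) = 0 := by ext t; exact deriv_const t (0 : ℝ)
      rw [this]
      exact MemLp.zero
  add_mem' := by
    rintro f g ⟨hf, hf1, hf2⟩ ⟨hg, hg1, hg2⟩
    exact ⟨fun a b => (hf a b).add (hg a b), hf1.add hg1,
      (hf2.add hg2).ae_eq (ac_deriv_add hf hg).symm⟩
  smul_mem' := by
    rintro c f ⟨hf, hf1, hf2⟩
    refine ⟨fun a b => (hf a b).const_mul c, hf1.const_smul c, ?_⟩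
    rw [deriv_smul_fun]
    exact hf2.const_smul c

/-- The Hilbert space `H^U` of absolutely continuous `h : ℝ → ℝ` with `∫ (h² / 4 + h'²) < ∞`,
with the inner product `(f, g) = ∫ (f g / 4 + f' g')` (see `EnergySpace.inner_eq`). -/
def EnergySpace : Type := energySubmodule

namespace EnergySpace

instance : AddCommGroup EnergySpace := inferInstanceAs (AddCommGroup energySubmodule)
instance : Module ℝ EnergySpace := inferInstanceAs (Module ℝ energySubmodule)
instance : FunLike EnergySpace ℝ ℝ where
  coe h := h.1
  coe_injective := Subtype.val_injective

theorem ac (h : EnergySpace) (a b : ℝ) : AbsolutelyContinuousOnInterval h a b := h.2.1 a b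
theorem memLp (h : EnergySpace) : MemLp h 2 := h.2.2.1
theorem memLp_deriv (h : EnergySpace) : MemLp (deriv h) 2 := h.2.2.2
theorem continuous (h : EnergySpace) : Continuous h := ac_continuous h.ac

theorem deriv_add' (f g : EnergySpace) : deriv (f + g : EnergySpace) =ᵐ[volume] deriv f + deriv g :=
  ac_deriv_add f.ac g.ac
theorem deriv_smul' (c : ℝ) (f : EnergySpace) : deriv (c • f : EnergySpace) = c • deriv f :=
  deriv_smul_fun c f

/-- The class of `h` in `L²(ℝ)`. -/
def toL2 : EnergySpace →ₗ[ℝ] Lp ℝ 2 (volume : Measure ℝ) where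
  toFun h := h.memLp.toLp h
  map_add' f g := MemLp.toLp_add f.memLp g.memLp
  map_smul' c f := MemLp.toLp_const_smul c f.memLp

/-- The class of `h'` in `L²(ℝ)`. -/
def derivL2 : EnergySpace →ₗ[ℝ] Lp ℝ 2 (volume : Measure ℝ) where
  toFun h := h.memLp_deriv.toLp (deriv h)
  map_add' f g := by
    rw [← MemLp.toLp_add f.memLp_deriv g.memLp_deriv]
    exact MemLp.toLp_congr _ _ (deriv_add' f g)
  map_smul' c f := by
    rw [RingHom.id_apply, ← MemLp.toLp_const_smul c f.memLp_deriv]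
    exact MemLp.toLp_congr _ _ (deriv_smul' c f).eventuallyEq

/-- The inner product of `H^U`. -/
def energyInner (f g : EnergySpace) : ℝ :=
  ∫ t : ℝ, (1 / 4 * (f t * g t) + deriv f t * deriv g t)

theorem energyInner_eq (f g : EnergySpace) : energyInner f g =
    1 / 4 * inner ℝ (toL2 f) (toL2 g) + inner ℝ (derivL2 f) (derivL2 g) := by
  have i1 : Integrable fun t => 1 / 4 * (f t * g t) :=
    (f.memLp.integrable_mul g.memLp).const_mul _
  have i2 : Integrable fun t => deriv f t * deriv g t := f.memLp_deriv.integrable_mul g.memLp_deriv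
  rw [energyInner, integral_add i1 i2, integral_const_mul, L2.inner_def, L2.inner_def]
  have e1 : ∫ t : ℝ, f t * g t = ∫ t : ℝ, inner ℝ (toL2 f t) (toL2 g t) := by
    refine integral_congr_ae ?_
    filter_upwards [f.memLp.coeFn_toLp, g.memLp.coeFn_toLp] with t h1 h2
    change _ = inner ℝ (f.memLp.toLp f t) (g.memLp.toLp g t)
    rw [h1, h2]
    exact mul_comm _ _
  have e2 : ∫ t : ℝ, deriv f t * deriv g t =
      ∫ t : ℝ, inner ℝ (derivL2 f t) (derivL2 g t) := by
    refine integral_congr_ae ?_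
    filter_upwards [f.memLp_deriv.coeFn_toLp, g.memLp_deriv.coeFn_toLp] with t h1 h2
    change _ = inner ℝ (f.memLp_deriv.toLp _ t) (g.memLp_deriv.toLp _ t)
    rw [h1, h2]
    exact mul_comm _ _
  rw [e1, e2]

theorem toL2_injective : Function.Injective toL2 := by
  intro f g h
  have h' : (f : ℝ → ℝ) =ᵐ[volume] g := (MemLp.toLp_eq_toLp_iff f.memLp g.memLp).1 h
  exact DFunLike.coe_injective ((f.continuous.ae_eq_iff_eq volume g.continuous).1 h')

/-- The inner product axioms. -/
abbrev innerCore : InnerProductSpace.Core ℝ EnergySpace where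
  inner := energyInner
  conj_inner_symm f g := by
    simp only [energyInner_eq, conj_trivial, real_inner_comm]
  re_inner_nonneg f := by
    have h1 : 0 ≤ inner ℝ (toL2 f) (toL2 f) := real_inner_self_nonneg
    have h2 : 0 ≤ inner ℝ (derivL2 f) (derivL2 f) := real_inner_self_nonneg
    simp only [energyInner_eq, RCLike.re_to_real]
    positivity
  add_left f g k := by
    simp only [energyInner_eq, map_add, inner_add_left]
    ring
  smul_left f g c := by
    simp only [energyInner_eq, map_smul, real_inner_smul_left, conj_trivial]
    ring
  definite f hf := by
    have h1 : 0 ≤ inner ℝ (toL2 f) (toL2 f) := real_inner_self_nonneg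
    have h2 : 0 ≤ inner ℝ (derivL2 f) (derivL2 f) := real_inner_self_nonneg
    rw [energyInner_eq] at hf
    have h3 : inner ℝ (toL2 f) (toL2 f) = 0 := by linarith
    rw [inner_self_eq_zero] at h3
    exact toL2_injective (h3.trans (map_zero toL2).symm)

instance : NormedAddCommGroup EnergySpace := innerCore.toNormedAddCommGroup
instance : InnerProductSpace ℝ EnergySpace := InnerProductSpace.ofCore innerCore.toCore

theorem inner_eq (f g : EnergySpace) :
    inner ℝ f g = ∫ t : ℝ, (1 / 4 * (f t * g t) + deriv f t * deriv g t) := rfl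

theorem norm_sq_eq (f : EnergySpace) : ‖f‖ ^ 2 = 1 / 4 * ‖toL2 f‖ ^ 2 + ‖derivL2 f‖ ^ 2 := by
  rw [← real_inner_self_eq_norm_sq, ← real_inner_self_eq_norm_sq, ← real_inner_self_eq_norm_sq]
  exact energyInner_eq f f

theorem norm_toL2_le (f : EnergySpace) : ‖toL2 f‖ ≤ 2 * ‖f‖ := by
  refine abs_le_of_sq_le_sq' ?_ (by positivity) |>.2
  nlinarith [norm_sq_eq f, sq_nonneg ‖derivL2 f‖]

theorem norm_derivL2_le (f : EnergySpace) : ‖derivL2 f‖ ≤ ‖f‖ := by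
  refine abs_le_of_sq_le_sq' ?_ (by positivity) |>.2
  nlinarith [norm_sq_eq f, sq_nonneg ‖toL2 f‖]

theorem abs_integral_le {g : ℝ → ℝ} (hg : MemLp g 2) {a b : ℝ} (hab : a ≤ b) :
    |∫ t in a..b, g t| ≤ √(b - a) * ‖hg.toLp g‖ := by
  have hfin : volume (Set.Ioc a b) ≠ ∞ := by simp
  have h := L2.inner_indicatorConstLp_one (𝕜 := ℝ) (measurableSet_Ioc (a := a) (b := b)) hfin
    (hg.toLp g)
  have h2 := abs_real_inner_le_norm
    (indicatorConstLp 2 (measurableSet_Ioc (a := a) (b := b)) hfin (1 : ℝ)) (hg.toLp g)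
  rw [h, norm_indicatorConstLp (by simp) (by simp)] at h2
  rw [intervalIntegral.integral_of_le hab]
  rw [setIntegral_congr_ae measurableSet_Ioc (g := g)
    (hg.coeFn_toLp.mono fun t ht _ => ht)] at h2
  simpa [Real.sqrt_eq_rpow, hab] using h2

theorem abs_sub_le (f : EnergySpace) {a b : ℝ} (hab : a ≤ b) :
    |f b - f a| ≤ √(b - a) * ‖f‖ := by
  rw [← (f.ac a b).integral_deriv_eq_sub]
  refine (abs_integral_le f.memLp_deriv hab).trans ?_
  gcongr
  exact norm_derivL2_le f

theorem abs_le (f : EnergySpace) (t : ℝ) : |f t| ≤ 3 * ‖f‖ := by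
  have hi : IntervalIntegrable (fun s => |f s|) volume t (t + 1) :=
    (continuous_abs.comp f.continuous).intervalIntegrable _ _
  have h1 : ∫ _ in t..(t + 1), |f t| ≤ ∫ s in t..(t + 1), (|f s| + ‖f‖) := by
    refine intervalIntegral.integral_mono_on (by linarith) (by simp)
      (hi.add (by simp)) fun s hs => ?_
    have h := f.abs_sub_le hs.1
    have h' : √(s - t) ≤ 1 := by
      rw [Real.sqrt_le_one]
      linarith [hs.2]
    have h3 : |f t| - |f s| ≤ |f s - f t| := by
      rw [abs_sub_comm]
      exact abs_sub_abs_le_abs_sub _ _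
    nlinarith [norm_nonneg f]
  rw [intervalIntegral.integral_add hi (by simp)] at h1
  have h2 := abs_integral_le f.memLp.abs (show t ≤ t + 1 by linarith)
  have h3 : ‖f.memLp.abs.toLp _‖ = ‖toL2 f‖ := by
    change _ = ‖f.memLp.toLp f‖
    rw [Lp.norm_toLp, Lp.norm_toLp]
    congr 1
    exact eLpNorm_norm (f : ℝ → ℝ)
  have h4 := norm_toL2_le f
  rw [h3] at h2
  have h6 : (∫ s in t..(t + 1), |f s|) ≤ √(t + 1 - t) * ‖toL2 f‖ := (le_abs_self _).trans h2
  simp only [intervalIntegral.integral_const, add_sub_cancel_left, one_smul, Real.sqrt_one,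
    one_mul] at h1 h6
  linarith

instance : CompleteSpace EnergySpace := by
  refine Metric.complete_of_cauchySeq_tendsto fun u hu => ?_
  have hu0 : CauchySeq fun n => toL2 (u n) :=
    (toL2.mkContinuous 2 norm_toL2_le).uniformContinuous.comp_cauchySeq hu
  have hu1 : CauchySeq fun n => derivL2 (u n) :=
    (derivL2.mkContinuous 1 (by simpa using norm_derivL2_le)).uniformContinuous.comp_cauchySeq hu
  have hu2 : CauchySeq fun n => u n 0 := by
    let e : EnergySpace →ₗ[ℝ] ℝ :=
      { toFun := fun f => f 0, map_add' := fun _ _ => rfl, map_smul' := fun _ _ => rfl }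
    exact (e.mkContinuous 3 fun f => f.abs_le 0).uniformContinuous.comp_cauchySeq hu
  obtain ⟨f, hf⟩ := cauchySeq_tendsto_of_complete hu0
  obtain ⟨g, hg⟩ := cauchySeq_tendsto_of_complete hu1
  obtain ⟨c, hc⟩ := cauchySeq_tendsto_of_complete hu2
  have hli : LocallyIntegrable g volume := (Lp.memLp g).locallyIntegrable (by norm_num)
  have hgi : ∀ a b, IntervalIntegrable g volume a b := fun a b => intervalIntegrable_iff.2 <|
    (hli.integrableOn_isCompact isCompact_uIcc).mono_set Set.uIoc_subset_uIcc
  let h : ℝ → ℝ := fun t => c + ∫ s in (0 : ℝ)..t, g s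
  have hac : ∀ a b, AbsolutelyContinuousOnInterval h a b := by
    intro a b
    have h0 : AbsolutelyContinuousOnInterval (fun _ : ℝ => c + ∫ s in (0 : ℝ)..a, g s) a b :=
      (contDiff_const (n := 1)).contDiffOn.absolutelyContinuousOnInterval
    have h1 := h0.add ((hgi a b).absolutelyContinuousOnInterval_intervalIntegral
      (c := a) Set.left_mem_uIcc)
    have h2 : h = (fun _ : ℝ => c + ∫ s in (0 : ℝ)..a, g s) + fun t => ∫ s in a..t, g s := by
      funext t
      change c + _ = c + _ + _
      rw [add_assoc, intervalIntegral.integral_add_adjacent_intervals (hgi 0 a) (hgi a t)]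
    rw [h2]
    exact h1
  have hder : deriv h =ᵐ[volume] g := by
    filter_upwards [LocallyIntegrable.ae_hasDerivAt_integral hli] with t ht
    exact ((ht 0).const_add c).deriv
  have hlim : ∀ t, Tendsto (fun n => u n t) atTop (𝓝 (h t)) := by
    intro t
    have : ∀ n, u n t = u n 0 + ∫ s in (0 : ℝ)..t, derivL2 (u n) s := by
      intro n
      have h1 := ((u n).ac 0 t).integral_deriv_eq_sub
      have h2 : ∫ s in (0 : ℝ)..t, derivL2 (u n) s = ∫ s in (0 : ℝ)..t, deriv (u n) s :=
        intervalIntegral.integral_congr_ae ((u n).memLp_deriv.coeFn_toLp.mono fun s hs _ => hs)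
      rw [h2, h1]
      ring
    simp only [this]
    refine hc.add ?_
    have key : ∀ a b : ℝ, a ≤ b → Tendsto (fun n => ∫ s in a..b, derivL2 (u n) s) atTop
        (𝓝 (∫ s in a..b, g s)) := by
      intro a b hab
      have hfin : volume (Set.Ioc a b) ≠ ∞ := by simp
      simp only [intervalIntegral.integral_of_le hab,
        ← L2.inner_indicatorConstLp_one (𝕜 := ℝ) (measurableSet_Ioc (a := a) (b := b)) hfin]
      exact tendsto_const_nhds.inner hg
    rcases le_total 0 t with ht | ht
    · exact key 0 t ht
    · simp only [intervalIntegral.integral_symm t 0]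
      exact (key t 0 ht).neg
  have hfh : f =ᵐ[volume] h := by
    obtain ⟨ns, hns, hns'⟩ := (tendstoInMeasure_of_tendsto_Lp hf).exists_seq_tendsto_ae
    have h1 : ∀ᵐ t : ℝ, ∀ n, toL2 (u n) t = u n t := ae_all_iff.2 fun n => (u n).memLp.coeFn_toLp
    filter_upwards [hns', h1] with t ht ht1
    refine tendsto_nhds_unique ht ?_
    simp only [ht1]
    exact (hlim t).comp hns.tendsto_atTop
  have hm : h ∈ energySubmodule :=
    ⟨hac, (Lp.memLp f).ae_eq hfh, (Lp.memLp g).ae_eq hder.symm⟩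
  let k : EnergySpace := ⟨h, hm⟩
  have hk0 : toL2 k = f := by
    refine Lp.ext (k.memLp.coeFn_toLp.trans hfh.symm)
  have hk1 : derivL2 k = g := by
    refine Lp.ext (k.memLp_deriv.coeFn_toLp.trans hder)
  refine ⟨k, tendsto_iff_norm_sub_tendsto_zero.2 ?_⟩
  have h2 : Tendsto (fun n => ‖u n - k‖ ^ 2) atTop (𝓝 0) := by
    simp only [norm_sq_eq, map_sub, hk0, hk1]
    have e0 := ((tendsto_iff_norm_sub_tendsto_zero.1 hf).pow 2).const_mul (1 / 4 : ℝ)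
    have e1 := (tendsto_iff_norm_sub_tendsto_zero.1 hg).pow 2
    simpa using e0.add e1
  have h3 := h2.sqrt
  simpa using h3

end EnergySpace

namespace EnergySpace

theorem mem_pathSubmodule (f : EnergySpace) : (f : ℝ → ℝ) ∈ pathSubmodule := by
  refine ⟨f.continuous, ?_⟩
  have h : Tendsto (fun t : ℝ => 3 * ‖f‖ / Real.log |t|) (cocompact ℝ) (𝓝 0) :=
    (Real.tendsto_log_atTop.comp (tendsto_norm_cocompact_atTop (E := ℝ))).const_div_atTop _
  refine squeeze_zero_norm' ?_ h
  filter_upwards [(tendsto_norm_cocompact_atTop (E := ℝ)).eventually_ge_atTop 1] with t ht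
  have hl : 0 ≤ Real.log |t| := Real.log_nonneg ht
  rw [Real.norm_of_nonneg (by positivity)]
  gcongr
  exact f.abs_le t

/-- The embedding of `H^U` into `𝒰`. -/
def toPath : EnergySpace →L[ℝ] PathSpace :=
  LinearMap.mkContinuous
    { toFun := fun f => (⟨f, f.mem_pathSubmodule⟩ : pathSubmodule)
      map_add' := fun _ _ => rfl
      map_smul' := fun _ _ => rfl } 3 (by
    intro f
    rw [PathSpace.norm_eq]
    refine ciSup_le fun t => ?_
    have h1 : (Real.log (Real.exp 1 + |t|))⁻¹ ≤ 1 := inv_le_one_of_one_le₀ (PathSpace.one_le_weight t)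
    exact (mul_le_of_le_one_left (abs_nonneg _) h1).trans (f.abs_le t))

theorem toPath_apply (f : EnergySpace) (t : ℝ) : toPath f t = f t := rfl

theorem mem_of_schwartz (φ : 𝓢(ℝ, ℝ)) : (φ : ℝ → ℝ) ∈ energySubmodule := by
  refine ⟨fun a b => ?_, φ.memLp 2, ?_⟩
  · exact (φ.smooth 1).contDiffOn.absolutelyContinuousOnInterval
  · exact (SchwartzMap.derivCLM ℝ ℝ φ).memLp 2

/-- The inclusion of the real Schwartz functions in `H^U`. -/
def ofSchwartz : 𝓢(ℝ, ℝ) →ₗ[ℝ] EnergySpace where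
  toFun φ := (⟨φ, mem_of_schwartz φ⟩ : energySubmodule)
  map_add' _ _ := rfl
  map_smul' _ _ := rfl

theorem ofSchwartz_apply (φ : 𝓢(ℝ, ℝ)) (t : ℝ) : ofSchwartz φ t = φ t := rfl

end EnergySpace

/-! ### The distributions `μ^{*u}` and the convolutions with them -/

/-- The function `e^{-2 i u arctan(2λ)}` at `λ = 2πξ`. In terms of the transform
`φ̂(λ) = ∫ e^{-iλt} φ(t) dt`, Mathlib's Fourier transform is `𝓕 φ (ξ) = φ̂(2πξ)`. -/
def multiplier (u ξ : ℝ) : ℂ :=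
  Complex.exp (-2 * Complex.I * u * Real.arctan (2 * (2 * Real.pi * ξ)))

theorem hasTemperateGrowth_arctan : Real.arctan.HasTemperateGrowth := by
  have h1 : Function.HasTemperateGrowth fun x : ℝ => (1 + ‖x‖ ^ 2) ^ (-1 : ℝ) := by fun_prop
  let L : ℝ →L[ℝ] ℝ →L[ℝ] ℝ := ContinuousLinearMap.toSpanSingleton ℝ (ContinuousLinearMap.id ℝ ℝ)
  have h2 : fderiv ℝ Real.arctan = L ∘ fun x => (1 + ‖x‖ ^ 2) ^ (-1 : ℝ) := by
    ext x
    rw [fderiv_apply_one_eq_deriv, Real.deriv_arctan]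
    simp [L, Real.rpow_neg_one]
  refine Function.HasTemperateGrowth.of_fderiv (k := 0) (C := Real.pi) ?_
    Real.differentiable_arctan fun x => ?_
  · rw [h2]
    exact L.hasTemperateGrowth.comp h1
  · have h3 := Real.neg_pi_div_two_lt_arctan x
    have h4 := Real.arctan_lt_pi_div_two x
    rw [pow_zero, mul_one, Real.norm_eq_abs, abs_le]
    constructor <;> linarith [Real.pi_pos]

theorem hasTemperateGrowth_cexp (c : ℝ) :
    Function.HasTemperateGrowth fun x : ℝ => Complex.exp (c * Complex.I * x) := by
  have hd : ∀ n : ℕ, iteratedDeriv n (fun x : ℝ => Complex.exp (c * Complex.I * x)) =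
      fun x : ℝ => (c * Complex.I) ^ n * Complex.exp (c * Complex.I * x) := by
    intro n
    induction n with
    | zero => simp
    | succ n ih =>
      rw [iteratedDeriv_succ, ih]
      ext x
      have h : HasDerivAt (fun y : ℝ => (c * Complex.I * y : ℂ)) (c * Complex.I) x := by
        simpa using (Complex.ofRealCLM.hasDerivAt (x := x)).const_mul (c * Complex.I)
      rw [((h.cexp).const_mul _).deriv]
      ring
  refine ⟨?_, fun n => ⟨0, |c| ^ n, fun x => ?_⟩⟩
  · exact (contDiff_const.mul Complex.ofRealCLM.contDiff).cexp
  · rw [norm_iteratedFDeriv_eq_norm_iteratedDeriv, hd, norm_mul, norm_pow, norm_mul,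
      Complex.norm_I, Complex.norm_real, Complex.norm_exp]
    simp

theorem hasTemperateGrowth_multiplier (u : ℝ) : (multiplier u).HasTemperateGrowth := by
  have h : multiplier u = (fun x : ℝ => Complex.exp (((-2 * u : ℝ) : ℂ) * Complex.I * x)) ∘
      Real.arctan ∘ fun ξ : ℝ => (2 * (2 * Real.pi)) * ξ := by
    ext ξ
    simp only [multiplier, Function.comp_apply]
    congr 1
    push_cast
    ring_nf
  rw [h]
  refine (hasTemperateGrowth_cexp _).comp (hasTemperateGrowth_arctan.comp ?_)
  fun_prop

/-- The tempered distribution `μ^{*u}`, whose Fourier transform is `e^{-2 i u arctan(2λ)}`. -/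
def muPow (u : ℝ) : 𝓢'(ℝ, ℂ) := 𝓕⁻ (hasTemperateGrowth_multiplier u).toTemperedDistribution

theorem fourier_muPow (u : ℝ) :
    𝓕 (muPow u) = (hasTemperateGrowth_multiplier u).toTemperedDistribution := by
  rw [muPow, FourierTransform.fourier_fourierInv_eq]

/-- The convolution `φ * μ^{*u}` of a Schwartz function with `μ^{*u}`: the Schwartz function whose
Fourier transform is that of `φ` times that of `μ^{*u}`. By `schwartzConv_apply` below, its value
at `x` is `⟨μ^{*u}, φ(x - ·)⟩`. -/
def schwartzConv (u : ℝ) : 𝓢(ℝ, ℂ) →L[ℂ] 𝓢(ℝ, ℂ) :=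
  SchwartzMap.fourierMultiplierCLM ℂ (multiplier u)

theorem fourier_schwartzConv (u : ℝ) (φ : 𝓢(ℝ, ℂ)) (ξ : ℝ) :
    𝓕 (schwartzConv u φ) ξ = multiplier u ξ * 𝓕 φ ξ := by
  rw [schwartzConv, SchwartzMap.fourierMultiplierCLM_apply, FourierTransform.fourier_fourierInv_eq,
    SchwartzMap.smulLeftCLM_apply_apply (hasTemperateGrowth_multiplier u), smul_eq_mul]

/-- The Schwartz function `φ(x - ·)`. -/
def reflectAt (x : ℝ) (φ : 𝓢(ℝ, ℂ)) : 𝓢(ℝ, ℂ) :=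
  SchwartzMap.compSubConstCLM ℂ x
    (SchwartzMap.compCLMOfContinuousLinearEquiv ℂ (ContinuousLinearEquiv.neg ℝ) φ)

theorem reflectAt_apply (x : ℝ) (φ : 𝓢(ℝ, ℂ)) (y : ℝ) : reflectAt x φ y = φ (x - y) := by
  simp [reflectAt]

theorem multiplier_neg (u ξ : ℝ) : multiplier u (-ξ) = multiplier (-u) ξ := by
  simp only [multiplier, mul_neg, Real.arctan_neg]
  congr 1
  push_cast
  ring

theorem conj_multiplier (u ξ : ℝ) :
    (starRingEnd ℂ) (multiplier u ξ) = multiplier u (-ξ) := by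
  rw [multiplier_neg, multiplier, multiplier, ← Complex.exp_conj]
  congr 1
  simp only [map_mul, map_neg, Complex.conj_I, Complex.conj_ofReal, Complex.conj_ofNat]
  push_cast
  ring

theorem schwartzConv_eq_integral (u : ℝ) (φ : 𝓢(ℝ, ℂ)) (x : ℝ) : schwartzConv u φ x =
    ∫ ξ : ℝ, Complex.exp (↑(2 * Real.pi * (ξ * x)) * Complex.I) * (multiplier u ξ * 𝓕 φ ξ) := by
  rw [schwartzConv, SchwartzMap.fourierMultiplierCLM_apply, SchwartzMap.fourierInv_coe,
    Real.fourierInv_eq']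
  refine integral_congr_ae (Eventually.of_forall fun ξ => ?_)
  simp only [SchwartzMap.smulLeftCLM_apply_apply (hasTemperateGrowth_multiplier u), smul_eq_mul]
  simp [mul_comm x]

/-- `(φ * μ^{*u})(x) = ⟨μ^{*u}, φ(x - ·)⟩`. -/
theorem schwartzConv_apply (u : ℝ) (φ : 𝓢(ℝ, ℂ)) (x : ℝ) :
    schwartzConv u φ x = muPow u (reflectAt x φ) := by
  have h : ∀ ξ : ℝ, 𝓕⁻ (reflectAt x φ) ξ =
      Complex.exp (↑(2 * Real.pi * (ξ * x)) * Complex.I) * 𝓕 φ ξ := by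
    intro ξ
    rw [SchwartzMap.fourierInv_coe, SchwartzMap.fourier_coe, Real.fourierInv_eq',
      Real.fourier_eq', ← integral_const_mul, ← integral_sub_left_eq_self _ volume x]
    refine integral_congr_ae (Eventually.of_forall fun y => ?_)
    simp only [reflectAt_apply, sub_sub_cancel, smul_eq_mul, ← mul_assoc, ← Complex.exp_add]
    congr 2
    simp
    ring
  rw [schwartzConv_eq_integral]
  change _ = ∫ ξ : ℝ, 𝓕⁻ (reflectAt x φ) ξ • multiplier u ξ
  refine integral_congr_ae (Eventually.of_forall fun ξ => ?_)
  simp only [h, smul_eq_mul]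
  ring

/-- The convolution `T * μ^{*u}` of a tempered distribution with `μ^{*u}`:
`⟨φ, T * μ^{*u}⟩ = ⟨φ * μ^{*(-u)}, T⟩`. -/
def distConv (u : ℝ) (T : 𝓢'(ℝ, ℂ)) : 𝓢'(ℝ, ℂ) :=
  PointwiseConvergenceCLM.precomp ℂ (schwartzConv (-u)) T

theorem distConv_apply (u : ℝ) (T : 𝓢'(ℝ, ℂ)) (φ : 𝓢(ℝ, ℂ)) :
    distConv u T φ = T (schwartzConv (-u) φ) := rfl

/-- The Fourier transform of `T * μ^{*u}` is that of `T` times `e^{-2 i u arctan(2λ)}`. -/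
theorem distConv_eq (u : ℝ) (T : 𝓢'(ℝ, ℂ)) :
    distConv u T = TemperedDistribution.fourierMultiplierCLM ℂ (multiplier u) T := by
  ext φ
  rw [distConv_apply, TemperedDistribution.fourierMultiplierCLM_apply_apply]
  congr 1
  ext x
  rw [schwartzConv_eq_integral, SchwartzMap.fourier_coe (SchwartzMap.smulLeftCLM _ _ _),
    Real.fourier_eq', ← integral_neg_eq_self]
  refine integral_congr_ae (Eventually.of_forall fun ξ => ?_)
  simp only [SchwartzMap.smulLeftCLM_apply_apply (hasTemperateGrowth_multiplier u), smul_eq_mul,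
    ← multiplier_neg, neg_neg, SchwartzMap.fourierInv_apply_eq]
  simp [SchwartzMap.fourier_coe, mul_comm x]

/-- `φ ↦ φ * μ^{*u}` on real-valued Schwartz functions. The result is real-valued (see
`ofReal_realConv`), so that taking the real part only changes the codomain. -/
def realConv (u : ℝ) : 𝓢(ℝ, ℝ) →ₗ[ℝ] 𝓢(ℝ, ℝ) :=
  (SchwartzMap.postcompCLM Complex.reCLM ∘L (schwartzConv u).restrictScalars ℝ ∘L
    SchwartzMap.postcompCLM Complex.ofRealCLM).toLinearMap

theorem ofReal_realConv (u : ℝ) (φ : 𝓢(ℝ, ℝ)) (x : ℝ) :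
    (realConv u φ x : ℂ) = schwartzConv u (φ.postcompCLM Complex.ofRealCLM) x := by
  change ((schwartzConv u (φ.postcompCLM Complex.ofRealCLM) x).re : ℂ) = _
  rw [← Complex.conj_eq_iff_re, schwartzConv_eq_integral, ← integral_conj, ← integral_neg_eq_self]
  refine integral_congr_ae (Eventually.of_forall fun ξ => ?_)
  have h : (starRingEnd ℂ) (𝓕 (φ.postcompCLM Complex.ofRealCLM) (-ξ)) =
      𝓕 (φ.postcompCLM Complex.ofRealCLM) ξ := by
    rw [SchwartzMap.fourier_coe, Real.fourier_eq', Real.fourier_eq', ← integral_conj]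
    refine integral_congr_ae (Eventually.of_forall fun y => ?_)
    simp [← Complex.exp_conj, map_ofNat]
  simp only [map_mul, h, conj_multiplier, neg_neg, ← Complex.exp_conj]
  simp [map_ofNat]


theorem realConv_realConv (u v : ℝ) (φ : 𝓢(ℝ, ℝ)) :
    realConv u (realConv v φ) = realConv (u + v) φ := by
  have h : (realConv v φ).postcompCLM Complex.ofRealCLM =
      schwartzConv v (φ.postcompCLM Complex.ofRealCLM) := by
    ext x
    exact ofReal_realConv v φ x
  have hm : multiplier u * multiplier v = multiplier (u + v) := by
    ext ξ
    simp only [Pi.mul_apply, multiplier, ← Complex.exp_add]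
    congr 1
    push_cast
    ring
  ext x
  apply Complex.ofReal_injective
  rw [ofReal_realConv, ofReal_realConv, h]
  simp only [schwartzConv]
  rw [SchwartzMap.fourierMultiplierCLM_fourierMultiplierCLM_apply
    (hasTemperateGrowth_multiplier u) (hasTemperateGrowth_multiplier v), hm]

theorem realConv_zero (φ : 𝓢(ℝ, ℝ)) : realConv 0 φ = φ := by
  have hm : multiplier 0 = fun _ => 1 := by
    ext ξ
    simp [multiplier]
  ext x
  apply Complex.ofReal_injective
  rw [ofReal_realConv, schwartzConv, hm, SchwartzMap.fourierMultiplierCLM_const]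
  simp

/-- The inverse of `φ ↦ φ * μ^{*u}` is `φ ↦ φ * μ^{*(-u)}`. -/
def realConvEquiv (u : ℝ) : 𝓢(ℝ, ℝ) ≃ₗ[ℝ] 𝓢(ℝ, ℝ) :=
  LinearEquiv.ofLinearMap (realConv u) (realConv (-u))
    (by
      ext φ : 1
      simp [realConv_realConv, realConv_zero])
    (by
      ext φ : 1
      simp [realConv_realConv, realConv_zero])

theorem norm_multiplier (u ξ : ℝ) : ‖multiplier u ξ‖ = 1 := by
  have h : -2 * Complex.I * u * Real.arctan (2 * (2 * Real.pi * ξ)) =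
      ((-2 * u * Real.arctan (2 * (2 * Real.pi * ξ)) : ℝ) : ℂ) * Complex.I := by
    push_cast
    ring
  rw [multiplier, h, Complex.norm_exp_ofReal_mul_I]

theorem norm_sq_ofSchwartz (φ : 𝓢(ℝ, ℝ)) : ‖EnergySpace.ofSchwartz φ‖ ^ 2 =
    ∫ ξ : ℝ, (1 / 4 + (2 * Real.pi * ξ) ^ 2) * ‖𝓕 (φ.postcompCLM Complex.ofRealCLM) ξ‖ ^ 2 := by
  set Φ := φ.postcompCLM Complex.ofRealCLM with hΦ
  have hd : ∀ ξ, 𝓕 (SchwartzMap.derivCLM ℂ ℂ Φ) ξ = (2 * Real.pi * Complex.I * ξ) • 𝓕 Φ ξ := by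
    intro ξ
    have := congrFun (Real.fourier_deriv Φ.integrable Φ.differentiable
      (SchwartzMap.derivCLM ℂ ℂ Φ).integrable) ξ
    exact this
  have hdφ : ∀ t, SchwartzMap.derivCLM ℂ ℂ Φ t = ((deriv φ t : ℝ) : ℂ) := by
    intro t
    exact (φ.hasDerivAt t).ofReal_comp.deriv
  have h0 : ∫ t : ℝ, φ t * φ t = ∫ ξ : ℝ, ‖𝓕 Φ ξ‖ ^ 2 := by
    rw [SchwartzMap.integral_norm_sq_fourier]
    refine integral_congr_ae (Eventually.of_forall fun t => ?_)
    simp [hΦ, sq]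
  have h1 : ∫ t : ℝ, deriv φ t * deriv φ t = ∫ ξ : ℝ, (2 * Real.pi * ξ) ^ 2 * ‖𝓕 Φ ξ‖ ^ 2 := by
    have : ∫ ξ : ℝ, (2 * Real.pi * ξ) ^ 2 * ‖𝓕 Φ ξ‖ ^ 2 =
        ∫ ξ : ℝ, ‖𝓕 (SchwartzMap.derivCLM ℂ ℂ Φ) ξ‖ ^ 2 := by
      refine integral_congr_ae (Eventually.of_forall fun ξ => ?_)
      simp only [hd, norm_smul, mul_pow]
      simp [mul_pow, abs_of_pos Real.pi_pos]
    rw [this, SchwartzMap.integral_norm_sq_fourier]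
    refine integral_congr_ae (Eventually.of_forall fun t => ?_)
    simp [hdφ, sq]
  have i0 : Integrable fun t : ℝ => 1 / 4 * (φ t * φ t) :=
    ((φ.memLp 2).integrable_mul (φ.memLp 2)).const_mul _
  have i1 : Integrable fun t : ℝ => deriv φ t * deriv φ t :=
    ((SchwartzMap.derivCLM ℝ ℝ φ).memLp 2).integrable_mul ((SchwartzMap.derivCLM ℝ ℝ φ).memLp 2)
  have j0 : Integrable fun ξ : ℝ => 1 / 4 * ‖𝓕 Φ ξ‖ ^ 2 :=
    (((𝓕 Φ).memLp 2).norm.integrable_sq).const_mul _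
  have j1 : Integrable fun ξ : ℝ => (2 * Real.pi * ξ) ^ 2 * ‖𝓕 Φ ξ‖ ^ 2 := by
    refine (((𝓕 (SchwartzMap.derivCLM ℂ ℂ Φ)).memLp 2).norm.integrable_sq).congr
      (Eventually.of_forall fun ξ => ?_)
    simp only [hd, norm_smul, mul_pow]
    simp [mul_pow, abs_of_pos Real.pi_pos]
  simp only [add_mul]
  rw [integral_add j0 j1, integral_const_mul, ← h0, ← h1, ← integral_const_mul,
    ← integral_add i0 i1, ← real_inner_self_eq_norm_sq]
  rfl

theorem norm_realConv (u : ℝ) (φ : 𝓢(ℝ, ℝ)) :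
    ‖EnergySpace.ofSchwartz (realConv u φ)‖ = ‖EnergySpace.ofSchwartz φ‖ := by
  have h : (realConv u φ).postcompCLM Complex.ofRealCLM =
      schwartzConv u (φ.postcompCLM Complex.ofRealCLM) := by
    ext x
    exact ofReal_realConv u φ x
  rw [← sq_eq_sq₀ (norm_nonneg _) (norm_nonneg _), norm_sq_ofSchwartz, norm_sq_ofSchwartz, h]
  simp only [fourier_schwartzConv, norm_mul, norm_multiplier, one_mul]

/-- Solvability of `φ / 4 - φ'' = ψ` in the Schwartz class. -/
theorem exists_resolvent (ψ : 𝓢(ℝ, ℝ)) : ∃ φ : 𝓢(ℝ, ℝ),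
    ∀ t, 1 / 4 * φ t - deriv (deriv φ) t = ψ t := by
  let m : ℝ → ℂ := fun ξ => (((1 / 4 + (2 * Real.pi * ξ) ^ 2)⁻¹ : ℝ) : ℂ)
  have hm : m.HasTemperateGrowth := by
    have h1 : (fun x : ℝ => (1 + ‖x‖ ^ 2) ^ (-1 : ℝ)).HasTemperateGrowth := by fun_prop
    have h2 : (fun ξ : ℝ => (4 * Real.pi) * ξ).HasTemperateGrowth := by fun_prop
    have h3 := Complex.ofRealCLM.hasTemperateGrowth.comp
      (((Function.HasTemperateGrowth.const (4 : ℝ)).mul (h1.comp h2)))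
    have h4 : m = fun ξ : ℝ => ((4 * (1 + ‖4 * Real.pi * ξ‖ ^ 2) ^ (-1 : ℝ) : ℝ) : ℂ) := by
      ext ξ
      simp only [m, Real.rpow_neg_one, Real.norm_eq_abs, sq_abs]
      congr 1
      rw [← div_eq_mul_inv, inv_eq_one_div, div_eq_div_iff (by positivity) (by positivity)]
      ring
    rw [h4]
    exact h3
  set Ψ := ψ.postcompCLM Complex.ofRealCLM with hΨ
  let Φ : 𝓢(ℝ, ℂ) := SchwartzMap.fourierMultiplierCLM ℂ m Ψ
  let D := SchwartzMap.derivCLM ℂ ℂ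
  have hF : ∀ ξ, 𝓕 Φ ξ = m ξ * 𝓕 Ψ ξ := by
    intro ξ
    simp only [Φ]
    rw [SchwartzMap.fourierMultiplierCLM_apply, FourierTransform.fourier_fourierInv_eq,
      SchwartzMap.smulLeftCLM_apply_apply hm, smul_eq_mul]
  have hd : ∀ (f : 𝓢(ℝ, ℂ)) ξ, 𝓕 (D f) ξ = (2 * Real.pi * Complex.I * ξ) • 𝓕 f ξ := by
    intro f ξ
    exact congrFun (Real.fourier_deriv f.integrable f.differentiable (D f).integrable) ξ
  have hE : (1 / 4 : ℂ) • Φ - D (D Φ) = Ψ := by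
    have : 𝓕 ((1 / 4 : ℂ) • Φ - D (D Φ)) = 𝓕 Ψ := by
      ext ξ
      rw [sub_eq_add_neg, FourierTransform.fourier_add, FourierTransform.fourier_neg,
        FourierTransform.fourier_smul]
      simp only [_root_.add_apply, _root_.neg_apply, _root_.smul_apply, hd, hF, smul_eq_mul, m]
      have : ((1 / 4 + (2 * Real.pi * ξ) ^ 2 : ℝ) : ℂ) ≠ 0 := by
        rw [Complex.ofReal_ne_zero]
        positivity
      push_cast at this ⊢
      linear_combination (𝓕 Ψ ξ) * (mul_inv_cancel₀ this) -
        (2 * Real.pi * ξ) ^ 2 * (1 / 4 + (2 * Real.pi * ξ : ℂ) ^ 2)⁻¹ * (𝓕 Ψ ξ) * Complex.I_sq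
    have h := congrArg (fun f => 𝓕⁻ f) this
    simpa using h
  refine ⟨Φ.postcompCLM Complex.reCLM, fun t => ?_⟩
  have hre : ∀ f : 𝓢(ℝ, ℂ), deriv (f.postcompCLM Complex.reCLM : 𝓢(ℝ, ℝ)) =
      fun t => (D f t).re := by
    intro f
    ext t
    exact (Complex.reCLM.hasFDerivAt.comp_hasDerivAt t (f.hasDerivAt t)).deriv
  have h := congrArg Complex.re (DFunLike.congr_fun hE t)
  rw [hre]
  have h2 := congrFun (hre (D Φ)) t
  have h3 : (fun t => (D Φ t).re) = ((D Φ).postcompCLM Complex.reCLM : 𝓢(ℝ, ℝ)) := rfl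
  rw [h3, h2]
  simpa [hΨ] using h

theorem memLp_deriv_schwartz (φ : 𝓢(ℝ, ℝ)) : MemLp (deriv φ) 2 :=
  (SchwartzMap.derivCLM ℝ ℝ φ).memLp 2 volume

theorem integral_deriv_mul_deriv (f : EnergySpace) (φ : 𝓢(ℝ, ℝ)) :
    ∫ t : ℝ, deriv f t * deriv φ t = -∫ t : ℝ, f t * deriv (deriv φ) t := by
  let D := SchwartzMap.derivCLM ℝ ℝ
  have i1 : Integrable fun t => f t * deriv (D φ) t :=
    f.memLp.integrable_mul (memLp_deriv_schwartz (D φ))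
  have i2 : Integrable fun t => deriv f t * D φ t := f.memLp_deriv.integrable_mul ((D φ).memLp 2)
  have hparts : ∀ n : ℕ, ∫ t in (-n : ℝ)..n, f t * deriv (D φ) t =
      f n * D φ n - f (-n) * D φ (-n) - ∫ t in (-n : ℝ)..n, deriv f t * D φ t := fun n =>
    (f.ac _ _).integral_mul_deriv_eq_deriv_mul
      ((D φ).smooth 1).contDiffOn.absolutelyContinuousOnInterval
  have hn : Tendsto (fun n : ℕ => (n : ℝ)) atTop atTop := tendsto_natCast_atTop_atTop
  have hn' : Tendsto (fun n : ℕ => -(n : ℝ)) atTop atBot := tendsto_neg_atTop_atBot.comp hn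
  have l1 := intervalIntegral_tendsto_integral i1 hn' hn
  have l2 := intervalIntegral_tendsto_integral i2 hn' hn
  have hz : Tendsto (fun t => f t * D φ t) (cocompact ℝ) (𝓝 0) := by
    have h := ((D φ).tendsto_cocompact.norm).const_mul (3 * ‖f‖)
    rw [norm_zero, mul_zero] at h
    refine squeeze_zero_norm (fun t => ?_) h
    rw [norm_mul]
    gcongr
    exact f.abs_le t
  have z1 := hz.comp (hn.mono_right atTop_le_cocompact)
  have z2 := hz.comp (hn'.mono_right atBot_le_cocompact)
  have l3 := (z1.sub z2).sub l2
  have := tendsto_nhds_unique l1 (l3.congr fun n => (hparts n).symm)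
  change ∫ t : ℝ, deriv f t * D φ t = -∫ t : ℝ, f t * deriv (D φ) t
  rw [this]
  ring

theorem denseRange_ofSchwartz : DenseRange EnergySpace.ofSchwartz := by
  have key : (LinearMap.range EnergySpace.ofSchwartz)ᗮ = ⊥ := by
    rw [Submodule.eq_bot_iff]
    intro f hf
    have h0 : ∀ ψ : 𝓢(ℝ, ℝ), ∫ t : ℝ, ψ t * f t = 0 := by
      intro ψ
      obtain ⟨φ, hφ⟩ := exists_resolvent ψ
      have h := hf (EnergySpace.ofSchwartz φ) ⟨φ, rfl⟩
      rw [real_inner_comm, EnergySpace.inner_eq] at h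
      have i0 : Integrable fun t : ℝ => 1 / 4 * (f t * φ t) :=
        (f.memLp.integrable_mul (φ.memLp 2)).const_mul _
      have i1 : Integrable fun t : ℝ => deriv f t * deriv φ t :=
        f.memLp_deriv.integrable_mul (memLp_deriv_schwartz φ)
      have i2 : Integrable fun t : ℝ => f t * deriv (deriv φ) t :=
        f.memLp.integrable_mul (memLp_deriv_schwartz (SchwartzMap.derivCLM ℝ ℝ φ))
      change ∫ t : ℝ, (1 / 4 * (f t * φ t) + deriv f t * deriv φ t) = 0 at h
      rw [integral_add i0 i1, integral_deriv_mul_deriv, ← sub_eq_add_neg,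
        ← integral_sub i0 i2] at h
      rw [← h]
      refine integral_congr_ae (Eventually.of_forall fun t => ?_)
      simp only [← hφ t]
      ring
    have h1 : ∀ᵐ t : ℝ, f t = 0 := by
      refine ae_eq_zero_of_integral_contDiff_smul_eq_zero
        f.continuous.locallyIntegrable fun g hg hg' => ?_
      exact h0 (hg'.toSchwartzMap hg)
    have h2 : (f : ℝ → ℝ) = 0 := (f.continuous.ae_eq_iff_eq volume continuous_zero).1 h1
    exact DFunLike.coe_injective h2
  have h := Submodule.topologicalClosure_eq_top_iff.2 key
  have h2 := Submodule.dense_iff_topologicalClosure_eq_top.2 h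
  exact h2


/-- The orthogonal transformation `𝒮^u` of `H^U`: the unique continuous extension of
`φ ↦ φ * μ^{*u}` from the (dense) subspace of Schwartz functions. -/
def orthFlow (u : ℝ) : EnergySpace ≃ₗᵢ[ℝ] EnergySpace :=
  (realConvEquiv u).extendOfIsometry EnergySpace.ofSchwartz EnergySpace.ofSchwartz
    denseRange_ofSchwartz denseRange_ofSchwartz (norm_realConv u)

theorem orthFlow_ofSchwartz (u : ℝ) (φ : 𝓢(ℝ, ℝ)) :
    orthFlow u (EnergySpace.ofSchwartz φ) = EnergySpace.ofSchwartz (realConv u φ) :=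
  LinearEquiv.extendOfIsometry_eq _ _ _ _ _ _ φ

/-! ### The Paley-Wiener map and the transformation attached to an orthogonal map

Here `i : H → E` is the inclusion of a Hilbert space `H` into a Banach space `E` with a Borel
measure `W`. -/

section AbstractWiener

variable {H E : Type*} [NormedAddCommGroup H] [InnerProductSpace ℝ H] [CompleteSpace H]
  [NormedAddCommGroup E] [NormedSpace ℝ E]

/-- The element `h_x` of `H` with `(h, h_x) = ⟨h, x⟩` for all `h ∈ H`, where `x ∈ E*`. -/
def rieszRep (i : H →L[ℝ] E) (x : StrongDual ℝ E) : H :=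
  (InnerProductSpace.toDual ℝ H).symm (x ∘L i)

theorem inner_rieszRep (i : H →L[ℝ] E) (x : StrongDual ℝ E) (h : H) :
    inner ℝ h (rieszRep i x) = x (i h) := by
  rw [real_inner_comm, rieszRep, InnerProductSpace.toDual_symm_apply]
  rfl

variable [MeasurableSpace E]

/-- `Y` is a version of `𝓘(h)`, where `𝓘 : H → L²(W)` is the Paley-Wiener map, the extension by
density and continuity of `h_x ↦ ⟨·, x⟩`: there are `x_n ∈ E*` such that `h_{x_n} → h` in `H` and
`⟨·, x_n⟩ → Y` in `L²(W)`. -/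
def IsPaleyWiener (i : H →L[ℝ] E) (W : Measure E) (h : H) (Y : E → ℝ) : Prop :=
  MemLp Y 2 W ∧ ∃ x : ℕ → StrongDual ℝ E,
    Tendsto (fun n => rieszRep i (x n)) atTop (𝓝 h) ∧
    Tendsto (fun n => eLpNorm (fun ω => x n ω - Y ω) 2 W) atTop (𝓝 0)

/-- `T : E → E` is (a version of) the transformation `T_O` attached to the orthogonal map `O`:
`𝓘(h) ∘ T = 𝓘(Oᵀ h)` holds `W`-almost surely for every `h ∈ H`. -/
structure IsAssociatedMap (i : H →L[ℝ] E) (W : Measure E) (O : H ≃ₗᵢ[ℝ] H) (T : E → E) : Prop where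
  aemeasurable : AEMeasurable T W
  comp_ae_eq : ∀ (h : H) (Y Z : E → ℝ), IsPaleyWiener i W h Y →
    IsPaleyWiener i W (O.symm h) Z → Y ∘ T =ᵐ[W] Z

end AbstractWiener

/-! ### The Ornstein-Uhlenbeck measure -/

/-- `W = F_* (Wiener measure)` with `(F θ)(t) = e^{-t/2} θ(e^t)`; that is, the image of `W` under
`F⁻¹`, given by `(F⁻¹ ω)(t) = √t ω(log t)` for `t > 0` and `(F⁻¹ ω)(0) = 0`, is the law of a
standard Brownian motion on `[0, ∞)`. This determines the Borel measure `W`. -/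
def IsOrnsteinUhlenbeckLaw (W : Measure PathSpace) : Prop :=
  ProbabilityTheory.IsBrownianReal
    (fun (t : ℝ≥0) (ω : PathSpace) => √(t : ℝ) * ω (Real.log t)) W

end OUFlow

end

open OUFlow

/-!
A real Schwartz function `φ` defines the functional `x_φ : ω ↦ ∫ φ ω` on `𝒰`, and `h_{x_φ}` is the
Schwartz solution of `h / 4 - h'' = φ`. Convolution commutes with this equation, so
`(𝒮^u)ᵀ h_{x_φ} = h_{x_ψ}` with `ψ = φ * μ^{*(-u)}` (`orthFlow_symm_rieszRep_pairing`). The defining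
property of `S^u` therefore reads `∫ φ S^u ω = ∫ ψ ω = ⟨φ, ω * μ^{*u}⟩` almost surely, for every
fixed `φ`. The Schwartz space is separable, so the null set can be chosen independently of `φ`, and
`S^u ω` represents `ω * μ^{*u}` (`IsOrnsteinUhlenbeckLaw.distConv_ae_eq`).

This uses that `h_x ↦ ⟨·, x⟩` is isometric on all of `𝒰*`. The Brownian hypothesis gives the law of
finite combinations of evaluations, whose variance is the norm in `H^U` because
`e^{-|s - t| / 2}` is both the covariance of the process and the reproducing kernel of `H^U`
(`EnergySpace.inner_kernel`, `IsOrnsteinUhlenbeckLaw.map_of_mem_span`). A general functional is a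
pointwise limit of such combinations (`PathSpace.exists_tendsto_span_eval`), and for Gaussian
variables this is enough to pass to the limit (`IsOrnsteinUhlenbeckLaw.map_eq_gaussianReal`).

For the existence of `S^u`, no continuity theorem for Gaussian processes is needed. The variables
`𝓘((𝒮^u)ᵀ k_q)`, for rational `q` and `k_q` the reproducing kernel, have the same joint law as the
values `ω(q)`. Restriction to rational times is a Borel isomorphism of `𝒰` onto a Borel subset of
`ℚ → ℝ`, since `𝒰` is Polish; so almost surely these variables are the values of a path, which
depends measurably on `ω` and has law `W` (`IsOrnsteinUhlenbeckLaw.exists_measurePreserving`). The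
kernels `k_q` span a dense subspace of `H^U`, hence this map is the one associated with `𝒮^u`
(`IsOrnsteinUhlenbeckLaw.exists_isAssociatedMap`).
-/

noncomputable section

namespace OUFlow

/-! ### Separability and approximation of functionals -/

section

open scoped unitInterval

/-- The extension by `0` of `s ↦ g (tan (π (s - 1/2)))` from `(0, 1)` to `[0, 1]`. The set where
the cosine does not vanish is the open interval `(0, 1)`. -/
def tanPullbackFun (g : ℝ → ℝ) (s : I) : ℝ :=
  open scoped Classical in
  if Real.cos (Real.pi * (s - 1 / 2)) = 0 then 0 else g (Real.tan (Real.pi * (s - 1 / 2)))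

theorem tanPullbackFun_of_cos_eq_zero (g : ℝ → ℝ) {s : I}
    (h : Real.cos (Real.pi * (s - 1 / 2)) = 0) : tanPullbackFun g s = 0 := if_pos h

theorem tanPullbackFun_of_cos_ne_zero (g : ℝ → ℝ) {s : I}
    (h : Real.cos (Real.pi * (s - 1 / 2)) ≠ 0) :
    tanPullbackFun g s = g (Real.tan (Real.pi * (s - 1 / 2))) := if_neg h

theorem exists_tanPullbackFun_eq (x : ℝ) : ∃ s : I, ∀ g : ℝ → ℝ, tanPullbackFun g s = g x := by
  have h1 := Real.neg_pi_div_two_lt_arctan x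
  have h2 := Real.arctan_lt_pi_div_two x
  have hpi := Real.pi_pos
  have hs : Real.arctan x / Real.pi + 1 / 2 ∈ I := by
    have e1 : -(1 / 2) ≤ Real.arctan x / Real.pi := by rw [le_div_iff₀ hpi]; linarith
    have e2 : Real.arctan x / Real.pi ≤ 1 / 2 := by rw [div_le_iff₀ hpi]; linarith
    exact ⟨by linarith, by linarith⟩
  have he : Real.pi * (Real.arctan x / Real.pi + 1 / 2 - 1 / 2) = Real.arctan x := by
    field_simp
    ring
  obtain ⟨s, hs'⟩ : ∃ s : I, (s : ℝ) = Real.arctan x / Real.pi + 1 / 2 := ⟨⟨_, hs⟩, rfl⟩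
  rw [← hs'] at he
  have hc : Real.cos (Real.pi * ((s : ℝ) - 1 / 2)) ≠ 0 := by
    rw [he]
    exact (Real.cos_arctan_pos x).ne'
  refine ⟨s, fun g => ?_⟩
  rw [tanPullbackFun_of_cos_ne_zero g hc, he, Real.tan_arctan]

theorem continuous_tanPullbackFun (g : C₀(ℝ, ℝ)) : Continuous (tanPullbackFun g) := by
  have hθ : Continuous fun s : I => Real.pi * ((s : ℝ) - 1 / 2) := by fun_prop
  have hcos : Continuous fun s : I => Real.cos (Real.pi * ((s : ℝ) - 1 / 2)) :=
    Real.continuous_cos.comp hθ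
  refine continuous_iff_continuousAt.2 fun s => ?_
  by_cases hs : Real.cos (Real.pi * ((s : ℝ) - 1 / 2)) = 0
  · rw [ContinuousAt, tanPullbackFun_of_cos_eq_zero _ hs, ← nhdsWithin_univ,
      ← Set.union_compl_self {r : I | Real.cos (Real.pi * ((r : ℝ) - 1 / 2)) = 0},
      nhdsWithin_union]
    refine Tendsto.sup ?_ ?_
    · refine tendsto_const_nhds.congr' ?_
      filter_upwards [self_mem_nhdsWithin] with r hr
      exact (tanPullbackFun_of_cos_eq_zero _ hr).symm
    · have h1 : Tendsto (fun r : I => Real.pi * ((r : ℝ) - 1 / 2))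
          (𝓝[{r : I | Real.cos (Real.pi * ((r : ℝ) - 1 / 2)) = 0}ᶜ] s)
          (𝓝[≠] (Real.pi * ((s : ℝ) - 1 / 2))) := by
        refine tendsto_nhdsWithin_iff.2 ⟨hθ.continuousAt.tendsto.mono_left nhdsWithin_le_nhds, ?_⟩
        filter_upwards [self_mem_nhdsWithin] with r hr hrs
        refine hr ?_
        rw [Set.mem_ofPred_eq, Set.mem_singleton_iff.1 hrs]
        exact hs
      have h2 := (Real.tendsto_abs_tan_of_cos_eq_zero hs).comp h1
      have h3 : Tendsto (fun r : I => Real.tan (Real.pi * ((r : ℝ) - 1 / 2)))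
          (𝓝[{r : I | Real.cos (Real.pi * ((r : ℝ) - 1 / 2)) = 0}ᶜ] s) (cocompact ℝ) :=
        (comap_norm_atTop (E := ℝ) ▸ Metric.cobounded_eq_cocompact (α := ℝ)) ▸ tendsto_comap_iff.2 h2
      refine ((zero_at_infty g).comp h3).congr' ?_
      filter_upwards [self_mem_nhdsWithin] with r hr
      exact (tanPullbackFun_of_cos_ne_zero g hr).symm
  · have h1 : ContinuousAt (fun r : I => g (Real.tan (Real.pi * ((r : ℝ) - 1 / 2)))) s := by
      refine (map_continuous g).continuousAt.comp ?_
      exact ContinuousAt.comp (f := fun r : I => Real.pi * ((r : ℝ) - 1 / 2))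
        (Real.continuousAt_tan.2 hs) hθ.continuousAt
    refine h1.congr ?_
    filter_upwards [hcos.continuousAt.eventually_ne hs] with r hr
    exact (tanPullbackFun_of_cos_ne_zero g hr).symm

/-- The isometric embedding of `C₀(ℝ)` into `C([0, 1])` given by `tanPullbackFun`. -/
def tanPullback : C₀(ℝ, ℝ) →ₗᵢ[ℝ] C(I, ℝ) where
  toFun g := ⟨tanPullbackFun g, continuous_tanPullbackFun g⟩
  map_add' f g := by
    ext s
    by_cases h : Real.cos (Real.pi * ((s : ℝ) - 1 / 2)) = 0
    · simp [tanPullbackFun_of_cos_eq_zero _ h]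
    · simp [tanPullbackFun_of_cos_ne_zero _ h]
  map_smul' c g := by
    ext s
    by_cases h : Real.cos (Real.pi * ((s : ℝ) - 1 / 2)) = 0
    · simp [tanPullbackFun_of_cos_eq_zero _ h]
    · simp [tanPullbackFun_of_cos_ne_zero _ h]
  norm_map' g := by
    refine le_antisymm ?_ ?_
    · refine (ContinuousMap.norm_le _ (norm_nonneg g)).2 fun s => ?_
      change ‖tanPullbackFun g s‖ ≤ ‖g‖
      by_cases h : Real.cos (Real.pi * ((s : ℝ) - 1 / 2)) = 0
      · simp [tanPullbackFun_of_cos_eq_zero _ h]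
      · rw [tanPullbackFun_of_cos_ne_zero _ h]
        exact g.toBCF.norm_coe_le_norm _
    · rw [← ZeroAtInftyContinuousMap.norm_toBCF_eq_norm (f := g)]
      refine (BoundedContinuousFunction.norm_le (norm_nonneg _)).2 fun x => ?_
      obtain ⟨s, hs⟩ := exists_tanPullbackFun_eq x
      have h := ContinuousMap.norm_coe_le_norm
        (⟨tanPullbackFun g, continuous_tanPullbackFun g⟩ : C(I, ℝ)) s
      change ‖tanPullbackFun g s‖ ≤ _ at h
      rw [hs] at h
      exact h

instance : SecondCountableTopology C₀(ℝ, ℝ) :=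
  tanPullback.isometry.isUniformInducing.isInducing.secondCountableTopology

namespace PathSpace

/-- `toC0` as a surjective linear isometry. -/
def toC0Equiv : PathSpace ≃ₗᵢ[ℝ] C₀(ℝ, ℝ) :=
  LinearIsometryEquiv.ofSurjective ⟨toC0, fun _ => rfl⟩ <| by
    intro g
    have hc : Continuous fun t => g t * weight t := (map_continuous g).mul continuous_weight
    have hlim : Tendsto (fun t => |g t * weight t| / Real.log |t|) (cocompact ℝ) (𝓝 0) := by
      have h0 : Tendsto (fun t => 2 * |g t|) (cocompact ℝ) (𝓝 0) := by
        simpa using (zero_at_infty g).abs.const_mul 2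
      refine squeeze_zero_norm' ?_ h0
      filter_upwards [(tendsto_norm_cocompact_atTop (E := ℝ)).eventually_ge_atTop (Real.exp 1)]
        with t ht
      rw [Real.norm_eq_abs] at ht
      have he : (2 : ℝ) ≤ Real.exp 1 := by
        have := Real.add_one_le_exp (1 : ℝ)
        linarith
      have hl : 0 < Real.log |t| := Real.log_pos (by linarith)
      have hw : weight t ≤ 2 * Real.log |t| := by
        -- `e + |t| ≤ |t| ^ 2` for `|t| ≥ e`
        have h2 : (2 : ℝ) * Real.log |t| = Real.log (|t| ^ 2) := by
          rw [Real.log_pow]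
          norm_num
        rw [h2]
        refine Real.log_le_log (by positivity) ?_
        nlinarith
      rw [Real.norm_of_nonneg (by positivity), div_le_iff₀ hl, abs_mul, abs_of_pos (weight_pos t)]
      nlinarith [abs_nonneg (g t)]
    refine ⟨(⟨fun t => g t * weight t, hc, hlim⟩ : pathSubmodule), ?_⟩
    ext t
    change g t * weight t / weight t = g t
    rw [mul_div_cancel_right₀ _ (weight_pos t).ne']

instance : SecondCountableTopology PathSpace :=
  toC0Equiv.toHomeomorph.isInducing.secondCountableTopology

instance : CompleteSpace PathSpace :=
  (completeSpace_congr toC0Equiv.isometry.isUniformEmbedding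
    (e := toC0Equiv.toLinearEquiv.toEquiv)).2 inferInstance

/-- The evaluation at time `t`, a continuous linear functional on the path space. -/
def eval (t : ℝ) : StrongDual ℝ PathSpace :=
  LinearMap.mkContinuous
    { toFun := fun ω => ω t, map_add' := fun _ _ => rfl, map_smul' := fun _ _ => rfl } (weight t)
    fun ω => by
      rw [mul_comm]
      exact ω.abs_le t

@[simp] theorem eval_apply (t : ℝ) (ω : PathSpace) : eval t ω = ω t := rfl

/-- Restriction of paths to rational times is a Borel isomorphism onto a Borel set, by the
Lusin-Souslin theorem. -/
theorem measurableEmbedding_restrict :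
    MeasurableEmbedding fun (ω : PathSpace) (q : ℚ) => ω (q : ℝ) := by
  refine Measurable.measurableEmbedding ?_ ?_
  · exact measurable_pi_lambda _ fun q => (eval (q : ℝ)).continuous.measurable
  · intro ω η h
    refine DFunLike.coe_injective ?_
    exact Rat.isDenseEmbedding_coe_real.dense.equalizer ω.continuous η.continuous h

/-- Every continuous linear functional is a pointwise limit of finite combinations of evaluations:
extend it from `C₀(ℝ)` to `C([0, 1])` by Hahn-Banach, and apply it to Bernstein polynomials. -/
theorem exists_tendsto_span_eval (x : StrongDual ℝ PathSpace) :
    ∃ y : ℕ → StrongDual ℝ PathSpace, (∀ n, y n ∈ Submodule.span ℝ (Set.range eval)) ∧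
      ∀ ω, Tendsto (fun n => y n ω) atTop (𝓝 (x ω)) := by
  let J : PathSpace →ₗᵢ[ℝ] C(I, ℝ) := tanPullback.comp toC0Equiv.toLinearIsometry
  have hJ : ∀ (s : I) (ω : PathSpace), J ω s = tanPullbackFun (toC0 ω) s := fun _ _ => rfl
  obtain ⟨z, hz, -⟩ := exists_extension_norm_eq (LinearMap.range J.toLinearMap)
    (x ∘L (J.equivRange.symm.toContinuousLinearEquiv : _ →L[ℝ] PathSpace))
  have hz' : ∀ ω, z (J ω) = x ω := by
    intro ω
    refine (hz (J.equivRange ω)).trans ?_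
    simp
  have hδ : ∀ s : I, ∃ d ∈ Submodule.span ℝ (Set.range eval), ∀ ω, d ω = J ω s := by
    intro s
    by_cases h : Real.cos (Real.pi * ((s : ℝ) - 1 / 2)) = 0
    · refine ⟨0, Submodule.zero_mem _, fun ω => ?_⟩
      rw [hJ, tanPullbackFun_of_cos_eq_zero _ h]
      rfl
    · set t := Real.tan (Real.pi * ((s : ℝ) - 1 / 2)) with ht
      refine ⟨(weight t)⁻¹ • eval t, Submodule.smul_mem _ _ (Submodule.subset_span ⟨t, rfl⟩),
        fun ω => ?_⟩
      rw [hJ, tanPullbackFun_of_cos_ne_zero _ h, toC0_apply, div_eq_inv_mul]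
      rfl
  choose d hd hd' using hδ
  refine ⟨fun n => ∑ k : Fin (n + 1), z (bernstein n k) • d (bernstein.z k), fun n =>
    Submodule.sum_mem _ fun k _ => Submodule.smul_mem _ _ (hd _), fun ω => ?_⟩
  have h := (z.continuous.tendsto _).comp (bernsteinApproximation_uniform (J ω))
  rw [hz'] at h
  refine h.congr fun n => ?_
  rw [Function.comp_apply, bernsteinApproximation, map_sum, _root_.sum_apply]
  refine Finset.sum_congr rfl fun k _ => ?_
  have e : bernstein n k • ContinuousMap.const I (J ω (bernstein.z k)) =
      J ω (bernstein.z k) • bernstein n k := by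
    ext s
    simp [mul_comm]
  rw [e, map_smul, _root_.smul_apply, hd', smul_eq_mul, smul_eq_mul, mul_comm]

end PathSpace

end

theorem coe_derivCLM_iterate (n : ℕ) (φ : 𝓢(ℝ, ℝ)) :
    ⇑((SchwartzMap.derivCLM ℝ ℝ)^[n] φ) = iteratedDeriv n φ := by
  induction n with
  | zero => simp
  | succ n ih =>
    rw [Function.iterate_succ_apply', iteratedDeriv_succ, ← ih]
    rfl

/-- The Schwartz topology is induced by the maps `φ ↦ x ^ k * φ⁽ⁿ⁾` into `C₀(ℝ)`. -/
theorem isInducing_schwartz : Topology.IsInducing fun (φ : 𝓢(ℝ, ℝ)) (i : ℕ × ℕ) =>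
    SchwartzMap.toZeroAtInfty (SchwartzMap.smulLeftCLM ℝ (fun x : ℝ => x ^ i.1)
      ((SchwartzMap.derivCLM ℝ ℝ)^[i.2] φ)) := by
  set G := fun (φ : 𝓢(ℝ, ℝ)) (i : ℕ × ℕ) =>
    SchwartzMap.toZeroAtInfty (SchwartzMap.smulLeftCLM ℝ (fun x : ℝ => x ^ i.1)
      ((SchwartzMap.derivCLM ℝ ℝ)^[i.2] φ)) with hG
  have hval : ∀ φ i x, G φ i x = x ^ i.1 * iteratedDeriv i.2 φ x := by
    intro φ i x
    have ht : Function.HasTemperateGrowth fun x : ℝ => x ^ i.1 := by fun_prop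
    simp only [hG, SchwartzMap.toZeroAtInfty_apply, SchwartzMap.smulLeftCLM_apply_apply ht,
      coe_derivCLM_iterate, smul_eq_mul]
  have hnorm : ∀ φ i, ‖G φ i‖ = schwartzSeminormFamily ℝ ℝ ℝ i φ := by
    intro φ i
    refine le_antisymm ?_ ?_
    · rw [← ZeroAtInftyContinuousMap.norm_toBCF_eq_norm]
      refine (BoundedContinuousFunction.norm_le (apply_nonneg _ _)).2 fun x => ?_
      refine le_trans (le_of_eq ?_) (SchwartzMap.le_seminorm' ℝ i.1 i.2 φ x)
      change ‖G φ i x‖ = _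
      rw [hval, norm_mul, norm_pow, Real.norm_eq_abs, Real.norm_eq_abs]
    · refine SchwartzMap.seminorm_le_bound' ℝ i.1 i.2 φ (norm_nonneg _) fun x => ?_
      refine le_trans (le_of_eq ?_) ((G φ i).toBCF.norm_coe_le_norm x)
      change _ = ‖G φ i x‖
      rw [hval, norm_mul, norm_pow, Real.norm_eq_abs, Real.norm_eq_abs]
  let G' : 𝓢(ℝ, ℝ) →+ (ℕ × ℕ → C₀(ℝ, ℝ)) := AddMonoidHom.mk' G (by
    intro φ ψ
    ext i x
    have hadd : iteratedDeriv i.2 (φ + ψ : 𝓢(ℝ, ℝ)) x =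
        iteratedDeriv i.2 φ x + iteratedDeriv i.2 ψ x := by
      exact iteratedDeriv_add ((φ.smooth i.2).contDiffAt) ((ψ.smooth i.2).contDiffAt)
    rw [Pi.add_apply, ZeroAtInftyContinuousMap.add_apply, hval, hval, hval, hadd, mul_add])
  change Topology.IsInducing G'
  rw [IsTopologicalAddGroup.isInducing_iff_nhds_zero,
    (SeminormFamily.withSeminorms_iff_nhds_eq_iInf _).1 (schwartz_withSeminorms ℝ ℝ ℝ),
    nhds_pi, Filter.pi, comap_iInf]
  refine iInf_congr fun i => ?_
  rw [Pi.zero_apply, ← comap_norm_nhds_zero (E := C₀(ℝ, ℝ)), comap_comap, comap_comap]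
  exact congrArg (fun f => comap f (𝓝 (0 : ℝ))) (funext fun φ => (hnorm φ i).symm)

instance : SecondCountableTopology 𝓢(ℝ, ℝ) := isInducing_schwartz.secondCountableTopology

/-! ### Evaluations and smooth functionals in `H^U` -/

theorem abs_exp_sub_exp_le {a b : ℝ} (ha : a ≤ 0) (hb : b ≤ 0) :
    |Real.exp a - Real.exp b| ≤ |a - b| := by
  wlog h : b ≤ a generalizing a b
  · rw [abs_sub_comm, abs_sub_comm a]
    exact this hb ha (le_of_not_ge h)
  rw [abs_of_nonneg (sub_nonneg.2 (Real.exp_le_exp.2 h)), abs_of_nonneg (sub_nonneg.2 h)]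
  have h1 := Real.add_one_le_exp (b - a)
  have h2 : Real.exp b = Real.exp a * Real.exp (b - a) := by rw [← Real.exp_add]; ring_nf
  have h3 : Real.exp a ≤ 1 := Real.exp_le_one_iff.2 ha
  have h4 := Real.exp_pos a
  rw [h2]
  nlinarith

theorem ac_exp_neg_abs (t a b : ℝ) :
    AbsolutelyContinuousOnInterval (fun x => Real.exp (-|x - t| / 2)) a b := by
  refine LipschitzOnWith.absolutelyContinuousOnInterval (K := 1) ?_
  refine (LipschitzWith.of_dist_le_mul fun x y => ?_).lipschitzOnWith
  rw [Real.dist_eq, Real.dist_eq, NNReal.coe_one, one_mul]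
  refine (abs_exp_sub_exp_le (by linarith [abs_nonneg (x - t)])
    (by linarith [abs_nonneg (y - t)])).trans ?_
  have h1 := abs_abs_sub_abs_le_abs_sub (x - t) (y - t)
  have h2 : -|x - t| / 2 - -|y - t| / 2 = -((|x - t| - |y - t|) / 2) := by ring
  rw [h2, abs_neg, abs_div, abs_two]
  rw [sub_sub_sub_cancel_right] at h1
  linarith [abs_nonneg (x - y)]

theorem deriv_exp_neg_abs_of_lt {t x : ℝ} (h : t < x) :
    deriv (fun x => Real.exp (-|x - t| / 2)) x = -(1 / 2) * Real.exp (-|x - t| / 2) := by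
  have h1 : (fun x => Real.exp (-|x - t| / 2)) =ᶠ[𝓝 x] fun x => Real.exp (-(x - t) / 2) := by
    filter_upwards [lt_mem_nhds h] with y hy
    rw [abs_of_pos (sub_pos.2 hy)]
  have h2 : HasDerivAt (fun x => Real.exp (-(x - t) / 2)) (Real.exp (-(x - t) / 2) * (-1 / 2)) x :=
    ((((hasDerivAt_id x).sub_const t).neg).div_const 2).exp
  rw [h1.deriv_eq, h2.deriv, abs_of_pos (sub_pos.2 h)]
  ring

theorem deriv_exp_neg_abs_of_gt {t x : ℝ} (h : x < t) :
    deriv (fun x => Real.exp (-|x - t| / 2)) x = 1 / 2 * Real.exp (-|x - t| / 2) := by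
  have h1 : (fun x => Real.exp (-|x - t| / 2)) =ᶠ[𝓝 x] fun x => Real.exp ((x - t) / 2) := by
    filter_upwards [gt_mem_nhds h] with y hy
    rw [abs_of_neg (sub_neg.2 hy), neg_neg]
  have h2 : HasDerivAt (fun x => Real.exp ((x - t) / 2)) (Real.exp ((x - t) / 2) * (1 / 2)) x :=
    (((hasDerivAt_id x).sub_const t).div_const 2).exp
  rw [h1.deriv_eq, h2.deriv, abs_of_neg (sub_neg.2 h), neg_neg]
  ring

theorem memLp_exp_neg_abs (t : ℝ) : MemLp (fun x => Real.exp (-|x - t| / 2)) 2 := by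
  have hc : Continuous fun x => Real.exp (-|x - t| / 2) := by fun_prop
  rw [memLp_two_iff_integrable_sq hc.aestronglyMeasurable]
  have h : Integrable fun x : ℝ => Real.exp (-|x|) := by
    rw [← integrableOn_univ, ← Set.Iic_union_Ioi (a := (0 : ℝ))]
    refine IntegrableOn.union ?_ ?_
    · refine (integrableOn_exp_Iic 0).congr_fun (fun x hx => ?_) measurableSet_Iic
      rw [abs_of_nonpos hx, neg_neg]
    · refine (integrableOn_exp_neg_Ioi 0).congr_fun (fun x hx => ?_) measurableSet_Ioi
      simp only [abs_of_pos (Set.mem_Ioi.1 hx)]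
  refine (h.comp_sub_right t).congr (Eventually.of_forall fun x => ?_)
  simp only [← Real.exp_nat_mul]
  congr 1
  push_cast
  ring

theorem memLp_deriv_exp_neg_abs (t : ℝ) :
    MemLp (deriv fun x => Real.exp (-|x - t| / 2)) 2 := by
  refine (memLp_exp_neg_abs t).mono (measurable_deriv _).aestronglyMeasurable ?_
  filter_upwards [Measure.ae_ne volume t] with x hx
  rw [Real.norm_eq_abs, Real.norm_eq_abs, abs_of_pos (Real.exp_pos _)]
  have h0 := Real.exp_pos (-|x - t| / 2)
  rcases lt_or_gt_of_ne hx with h | h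
  · rw [deriv_exp_neg_abs_of_gt h, abs_of_pos (by positivity)]
    linarith
  · rw [deriv_exp_neg_abs_of_lt h, abs_of_neg (by linarith)]
    linarith

namespace EnergySpace

/-- The reproducing kernel `x ↦ e^{-|x - t| / 2}` of `H^U`, the fundamental solution of
`h / 4 - h'' = δ_t`. -/
def kernel (t : ℝ) : EnergySpace :=
  (⟨fun x => Real.exp (-|x - t| / 2),
    ac_exp_neg_abs t, memLp_exp_neg_abs t, memLp_deriv_exp_neg_abs t⟩ : energySubmodule)

theorem kernel_apply (t x : ℝ) : kernel t x = Real.exp (-|x - t| / 2) := rfl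

/-- The reproducing property. On either side of `t` the integrand is, up to the factor `± 1 / 2`,
the derivative of the product. -/
theorem inner_kernel (f : EnergySpace) (t : ℝ) : inner ℝ f (kernel t) = f t := by
  rw [inner_eq]
  have hi : Integrable fun x => 1 / 4 * (f x * kernel t x) + deriv f x * deriv (kernel t) x :=
    ((f.memLp.integrable_mul (kernel t).memLp).const_mul _).add
      (f.memLp_deriv.integrable_mul (kernel t).memLp_deriv)
  have hn : Tendsto (fun n : ℕ => (n : ℝ)) atTop atTop := tendsto_natCast_atTop_atTop
  have l := intervalIntegral_tendsto_integral hi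
    (tendsto_atBot_add_const_left _ t (tendsto_neg_atTop_atBot.comp hn))
    (tendsto_atTop_add_const_left _ t hn)
  refine tendsto_nhds_unique l ?_
  have hval : ∀ n : ℕ, ∫ x in (t + -(n : ℝ))..(t + n),
      (1 / 4 * (f x * kernel t x) + deriv f x * deriv (kernel t) x) =
      f t - 1 / 2 * (f (t + -n) + f (t + n)) * Real.exp (-n / 2) := by
    intro n
    have hn0 : (0 : ℝ) ≤ n := n.cast_nonneg
    have hl : ∫ x in (t + -(n : ℝ))..t,
        (1 / 4 * (f x * kernel t x) + deriv f x * deriv (kernel t) x) =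
        1 / 2 * (f t * kernel t t - f (t + -n) * kernel t (t + -n)) := by
      rw [← (f.ac _ _).integral_deriv_mul_eq_sub ((kernel t).ac _ _),
        ← intervalIntegral.integral_const_mul]
      refine intervalIntegral.integral_congr_ae ?_
      filter_upwards [Measure.ae_ne volume t] with x hx hx'
      rw [Set.uIoc_of_le (by linarith)] at hx'
      have h : deriv (kernel t) x = 1 / 2 * kernel t x :=
        deriv_exp_neg_abs_of_gt (lt_of_le_of_ne hx'.2 hx)
      rw [h]
      ring
    have hr : ∫ x in t..(t + (n : ℝ)),
        (1 / 4 * (f x * kernel t x) + deriv f x * deriv (kernel t) x) =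
        -(1 / 2) * (f (t + n) * kernel t (t + n) - f t * kernel t t) := by
      rw [← (f.ac _ _).integral_deriv_mul_eq_sub ((kernel t).ac _ _),
        ← intervalIntegral.integral_const_mul]
      refine intervalIntegral.integral_congr_ae (Eventually.of_forall fun x hx' => ?_)
      rw [Set.uIoc_of_le (by linarith)] at hx'
      have h : deriv (kernel t) x = -(1 / 2) * kernel t x := deriv_exp_neg_abs_of_lt hx'.1
      rw [h]
      ring
    rw [← intervalIntegral.integral_add_adjacent_intervals (b := t) hi.intervalIntegrable
      hi.intervalIntegrable, hl, hr]
    simp only [kernel_apply, add_sub_cancel_left, sub_self, abs_zero, neg_zero, zero_div,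
      Real.exp_zero, abs_neg, abs_of_nonneg hn0]
    ring
  have hz : Tendsto (fun n : ℕ => 1 / 2 * (f (t + -n) + f (t + n)) * Real.exp (-(n : ℝ) / 2))
      atTop (𝓝 0) := by
    have he : Tendsto (fun n : ℕ => 3 * ‖f‖ * Real.exp (-(n : ℝ) / 2)) atTop (𝓝 0) := by
      have h1 : Tendsto (fun n : ℕ => -(n : ℝ) / 2) atTop atBot :=
        (tendsto_neg_atTop_atBot.comp hn).atBot_div_const two_pos
      simpa using (Real.tendsto_exp_atBot.comp h1).const_mul (3 * ‖f‖)
    refine squeeze_zero_norm (fun n => ?_) he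
    rw [norm_mul, norm_mul, Real.norm_of_nonneg (Real.exp_pos _).le]
    refine mul_le_mul_of_nonneg_right ?_ (Real.exp_pos _).le
    have h1 := norm_add_le (f (t + -n)) (f (t + n))
    have h2 := f.abs_le (t + -n)
    have h3 := f.abs_le (t + n)
    rw [Real.norm_eq_abs (f _), Real.norm_eq_abs (f _)] at h1
    rw [Real.norm_of_nonneg (by norm_num)]
    linarith
  have := hz.const_sub (f t)
  rw [sub_zero] at this
  exact this.congr fun n => (hval n).symm

theorem rieszRep_eval (t : ℝ) : rieszRep toPath (PathSpace.eval t) = kernel t := by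
  refine ext_inner_left ℝ fun f => ?_
  rw [inner_rieszRep, inner_kernel]
  rfl

/-- A continuous function that vanishes at the rationals is zero, so the kernels at rational times
span a dense subspace. -/
theorem dense_span_kernel :
    Dense (Submodule.span ℝ (Set.range fun q : ℚ => kernel q) : Set EnergySpace) := by
  rw [Submodule.dense_iff_topologicalClosure_eq_top, Submodule.topologicalClosure_eq_top_iff,
    Submodule.eq_bot_iff]
  intro f hf
  have h : ∀ q : ℚ, f q = 0 := by
    intro q
    rw [← inner_kernel, real_inner_comm]
    exact hf _ (Submodule.subset_span ⟨q, rfl⟩)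
  refine DFunLike.coe_injective ?_
  exact Rat.isDenseEmbedding_coe_real.dense.equalizer f.continuous continuous_zero (funext h)

end EnergySpace

namespace PathSpace

/-- The functional `ω ↦ ∫ φ(t) ω(t) dt` attached to a real Schwartz function. -/
def pairing (φ : 𝓢(ℝ, ℝ)) : StrongDual ℝ PathSpace :=
  have hi : ∀ ω : PathSpace, Integrable fun t => φ t * ω t := fun ω => by
    simpa using (ω.integrable_mul (φ.postcompCLM Complex.ofRealCLM)).re
  LinearMap.mkContinuous
    { toFun := fun ω => ∫ t : ℝ, φ t * ω t
      map_add' := fun ω η => by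
        rw [← integral_add (hi ω) (hi η)]
        exact integral_congr_ae (Eventually.of_forall fun t => mul_add _ _ _)
      map_smul' := fun c ω => by
        rw [RingHom.id_apply, smul_eq_mul, ← integral_const_mul]
        exact integral_congr_ae (Eventually.of_forall fun t => mul_left_comm _ _ _) }
    (∫ t : ℝ, (3 * (‖t‖ ^ 0 * ‖φ t‖) + ‖t‖ ^ 1 * ‖φ t‖))
    fun ω => by
      rw [mul_comm, ← integral_const_mul]
      refine (norm_integral_le_integral_norm _).trans ?_
      refine integral_mono (hi ω).norm ?_ fun t => ?_
      · simpa using ω.integrable_bound (φ.postcompCLM Complex.ofRealCLM)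
      · have h := ω.norm_mul_le (φ.postcompCLM Complex.ofRealCLM) t
        simpa using h

theorem pairing_apply (φ : 𝓢(ℝ, ℝ)) (ω : PathSpace) : pairing φ ω = ∫ t : ℝ, φ t * ω t := rfl

theorem toDistribution_ofReal (ω : PathSpace) (φ : 𝓢(ℝ, ℝ)) :
    ω.toDistribution (φ.postcompCLM Complex.ofRealCLM) = (pairing φ ω : ℂ) := by
  rw [toDistribution_apply, pairing_apply, ← integral_complex_ofReal]
  refine integral_congr_ae (Eventually.of_forall fun t => ?_)
  simp

theorem distConv_toDistribution_ofReal (u : ℝ) (ω : PathSpace) (φ : 𝓢(ℝ, ℝ)) :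
    distConv u ω.toDistribution (φ.postcompCLM Complex.ofRealCLM) =
      (pairing (realConv (-u) φ) ω : ℂ) := by
  rw [distConv_apply, ← toDistribution_ofReal]
  congr 1
  ext x
  exact (ofReal_realConv (-u) φ x).symm

theorem rieszRep_pairing {φ ψ : 𝓢(ℝ, ℝ)} (h : ∀ t, 1 / 4 * ψ t - deriv (deriv ψ) t = φ t) :
    rieszRep EnergySpace.toPath (pairing φ) = EnergySpace.ofSchwartz ψ := by
  refine ext_inner_left ℝ fun f => ?_
  rw [inner_rieszRep, pairing_apply, EnergySpace.inner_eq]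
  have i0 : Integrable fun t : ℝ => 1 / 4 * (f t * ψ t) :=
    (f.memLp.integrable_mul (ψ.memLp 2)).const_mul _
  have i1 : Integrable fun t : ℝ => deriv f t * deriv ψ t :=
    f.memLp_deriv.integrable_mul (memLp_deriv_schwartz ψ)
  have i2 : Integrable fun t : ℝ => f t * deriv (deriv ψ) t :=
    f.memLp.integrable_mul (memLp_deriv_schwartz (SchwartzMap.derivCLM ℝ ℝ ψ))
  change _ = ∫ t : ℝ, (1 / 4 * (f t * ψ t) + deriv f t * deriv ψ t)
  rw [integral_add i0 i1, integral_deriv_mul_deriv, ← sub_eq_add_neg, ← integral_sub i0 i2]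
  refine integral_congr_ae (Eventually.of_forall fun t => ?_)
  simp only [← h t, EnergySpace.toPath_apply]
  ring

end PathSpace

theorem derivCLM_schwartzConv (u : ℝ) (φ : 𝓢(ℝ, ℂ)) :
    SchwartzMap.derivCLM ℂ ℂ (schwartzConv u φ) = schwartzConv u (SchwartzMap.derivCLM ℂ ℂ φ) := by
  have hd : ∀ (f : 𝓢(ℝ, ℂ)) ξ, 𝓕 (SchwartzMap.derivCLM ℂ ℂ f) ξ =
      (2 * Real.pi * Complex.I * ξ) • 𝓕 f ξ := fun f ξ =>
    congrFun (Real.fourier_deriv f.integrable f.differentiable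
      (SchwartzMap.derivCLM ℂ ℂ f).integrable) ξ
  have h : 𝓕 (SchwartzMap.derivCLM ℂ ℂ (schwartzConv u φ)) =
      𝓕 (schwartzConv u (SchwartzMap.derivCLM ℂ ℂ φ)) := by
    ext ξ
    rw [hd, fourier_schwartzConv, fourier_schwartzConv, hd, smul_eq_mul, smul_eq_mul]
    ring
  simpa using congrArg (fun f => 𝓕⁻ f) h

theorem derivCLM_ofReal (φ : 𝓢(ℝ, ℝ)) :
    SchwartzMap.derivCLM ℂ ℂ (φ.postcompCLM Complex.ofRealCLM) =
      (SchwartzMap.derivCLM ℝ ℝ φ).postcompCLM Complex.ofRealCLM := by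
  ext t
  exact (φ.hasDerivAt t).ofReal_comp.deriv

theorem derivCLM_realConv (u : ℝ) (φ : 𝓢(ℝ, ℝ)) :
    SchwartzMap.derivCLM ℝ ℝ (realConv u φ) = realConv u (SchwartzMap.derivCLM ℝ ℝ φ) := by
  have h : (realConv u φ).postcompCLM Complex.ofRealCLM =
      schwartzConv u (φ.postcompCLM Complex.ofRealCLM) := by
    ext x
    exact ofReal_realConv u φ x
  ext x
  apply Complex.ofReal_injective
  rw [ofReal_realConv, ← derivCLM_ofReal, ← derivCLM_schwartzConv, ← h, derivCLM_ofReal]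
  rfl

theorem orthFlow_symm_ofSchwartz (u : ℝ) (φ : 𝓢(ℝ, ℝ)) :
    (orthFlow u).symm (EnergySpace.ofSchwartz φ) = EnergySpace.ofSchwartz (realConv (-u) φ) := by
  rw [LinearIsometryEquiv.symm_apply_eq, orthFlow_ofSchwartz, realConv_realConv, add_neg_cancel,
    realConv_zero]

/-- Convolution with `μ^{*(-u)}` commutes with the resolvent of `1 / 4 - d² / dt²`, so the transpose
of `𝒮^u` acts on the functionals `φ ↦ ∫ φ ω` by convolving `φ`. -/
theorem orthFlow_symm_rieszRep_pairing (u : ℝ) (φ : 𝓢(ℝ, ℝ)) :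
    (orthFlow u).symm (rieszRep EnergySpace.toPath (PathSpace.pairing φ)) =
      rieszRep EnergySpace.toPath (PathSpace.pairing (realConv (-u) φ)) := by
  obtain ⟨ψ, hψ⟩ := exists_resolvent φ
  rw [PathSpace.rieszRep_pairing hψ, orthFlow_symm_ofSchwartz]
  refine (PathSpace.rieszRep_pairing fun t => ?_).symm
  have h1 : (1 / 4 : ℝ) • ψ - SchwartzMap.derivCLM ℝ ℝ (SchwartzMap.derivCLM ℝ ℝ ψ) = φ := by
    ext t
    exact hψ t
  have h2 := congrArg (realConv (-u)) h1
  rw [map_sub, map_smul, ← derivCLM_realConv, ← derivCLM_realConv] at h2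
  exact DFunLike.congr_fun h2 t

/-! ### The Gaussian law of the continuous linear functionals -/

section Riesz

variable {H E : Type*} [NormedAddCommGroup H] [InnerProductSpace ℝ H] [CompleteSpace H]
  [NormedAddCommGroup E] [NormedSpace ℝ E]

theorem rieszRep_add (i : H →L[ℝ] E) (x y : StrongDual ℝ E) :
    rieszRep i (x + y) = rieszRep i x + rieszRep i y :=
  ext_inner_left ℝ fun h => by simp [inner_rieszRep, inner_add_right]

theorem rieszRep_smul (i : H →L[ℝ] E) (c : ℝ) (x : StrongDual ℝ E) :
    rieszRep i (c • x) = c • rieszRep i x :=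
  ext_inner_left ℝ fun h => by simp [inner_rieszRep, inner_smul_right]

/-- `x ↦ h_x` as a linear map. -/
def rieszRepₗ (i : H →L[ℝ] E) : StrongDual ℝ E →ₗ[ℝ] H where
  toFun := rieszRep i
  map_add' := rieszRep_add i
  map_smul' := rieszRep_smul i

@[simp] theorem rieszRepₗ_apply (i : H →L[ℝ] E) (x : StrongDual ℝ E) :
    rieszRepₗ i x = rieszRep i x := rfl

end Riesz

theorem denseRange_rieszRepₗ : DenseRange (rieszRepₗ EnergySpace.toPath) := by
  refine EnergySpace.dense_span_kernel.mono ?_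
  have h : Submodule.span ℝ (Set.range fun q : ℚ => EnergySpace.kernel q) ≤
      LinearMap.range (rieszRepₗ EnergySpace.toPath) := by
    rw [Submodule.span_le]
    rintro _ ⟨q, rfl⟩
    exact ⟨PathSpace.eval q, EnergySpace.rieszRep_eval _⟩
  exact h

namespace IsOrnsteinUhlenbeckLaw

open ProbabilityTheory

variable {W : Measure PathSpace}

theorem isPreBrownianReal (hW : IsOrnsteinUhlenbeckLaw W) :
    IsPreBrownianReal (fun (t : ℝ≥0) (ω : PathSpace) => √(t : ℝ) * ω (Real.log t)) W :=
  IsBrownianReal.toIsPreBrownianReal hW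

theorem eval_eq (t : ℝ) (ω : PathSpace) : ω t = Real.exp (-t / 2) *
    (√((Real.exp t).toNNReal : ℝ) * ω (Real.log (Real.exp t).toNNReal)) := by
  have h : √(Real.exp t) = Real.exp (t / 2) := (Real.exp_half t).symm
  rw [Real.coe_toNNReal _ (Real.exp_pos t).le, Real.log_exp, h, ← mul_assoc, ← Real.exp_add]
  ring_nf
  simp

theorem isGaussianProcess (hW : IsOrnsteinUhlenbeckLaw W) :
    IsGaussianProcess (fun (t : ℝ) (ω : PathSpace) => ω t) W := by
  have h := ((IsPreBrownianReal.isGaussianProcess (isPreBrownianReal hW)).comp_right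
    (fun t : ℝ => (Real.exp t).toNNReal)).smul fun t => Real.exp (-t / 2)
  have he : (fun (t : ℝ) (ω : PathSpace) => ω t) = fun t ω => Real.exp (-t / 2) *
      (√((Real.exp t).toNNReal : ℝ) * ω (Real.log (Real.exp t).toNNReal)) :=
    funext fun t => funext fun ω => eval_eq t ω
  rw [he]
  exact h

theorem integral_eval (hW : IsOrnsteinUhlenbeckLaw W) (t : ℝ) : ∫ ω : PathSpace, ω t ∂W = 0 := by
  rw [funext fun ω : PathSpace => eval_eq t ω, integral_const_mul]
  exact mul_eq_zero_of_right _ ((isPreBrownianReal hW).integral_eval _)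

theorem covariance_eval (hW : IsOrnsteinUhlenbeckLaw W) (s t : ℝ) :
    cov[fun ω : PathSpace => ω s, fun ω : PathSpace => ω t; W] = Real.exp (-|s - t| / 2) := by
  rw [funext fun ω : PathSpace => eval_eq s ω, funext fun ω : PathSpace => eval_eq t ω,
    covariance_const_mul_left, covariance_const_mul_right]
  refine (congrArg (fun c => Real.exp (-s / 2) * (Real.exp (-t / 2) * c))
    ((isPreBrownianReal hW).covariance_eval _ _)).trans ?_
  rw [NNReal.coe_min, Real.coe_toNNReal _ (Real.exp_pos s).le,
    Real.coe_toNNReal _ (Real.exp_pos t).le]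
  rcases le_total s t with h | h
  · rw [min_eq_left (Real.exp_le_exp.2 h), ← Real.exp_add, ← Real.exp_add,
      abs_of_nonpos (sub_nonpos.2 h)]
    ring_nf
  · rw [min_eq_right (Real.exp_le_exp.2 h), ← Real.exp_add, ← Real.exp_add,
      abs_of_nonneg (sub_nonneg.2 h)]
    ring_nf

/-- The law of a finite combination of evaluations; its variance is given by the reproducing kernel
of `H^U`, which is the covariance of the Ornstein-Uhlenbeck process. -/
theorem map_of_mem_span (hW : IsOrnsteinUhlenbeckLaw W) {y : StrongDual ℝ PathSpace}
    (hy : y ∈ Submodule.span ℝ (Set.range PathSpace.eval)) :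
    W.map y = gaussianReal 0 (‖rieszRep EnergySpace.toPath y‖ ^ 2).toNNReal := by
  have := (isGaussianProcess hW).isProbabilityMeasure
  obtain ⟨c, rfl⟩ := (Finsupp.mem_span_range_iff_exists_finsupp).1 hy
  have hc : ⇑(c.sum fun t a => a • PathSpace.eval t) =
      fun ω : PathSpace => ∑ t ∈ c.support, c t • ω t := by
    ext ω
    simp [Finsupp.sum]
  have hm : ∀ t, MemLp (fun ω : PathSpace => c t • ω t) 2 W := fun t =>
    ((isGaussianProcess hW).hasGaussianLaw_eval t).memLp_two.const_smul (c t)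
  have hG : HasGaussianLaw (fun ω : PathSpace => ∑ t ∈ c.support, c t • ω t) W :=
    ((isGaussianProcess hW).smul c).hasGaussianLaw_fun_sum
  have hmean : ∫ ω : PathSpace, ∑ t ∈ c.support, c t • ω t ∂W = 0 := by
    rw [integral_finsetSum _ fun t _ => (hm t).integrable one_le_two]
    refine Finset.sum_eq_zero fun t _ => ?_
    rw [integral_smul, integral_eval hW, smul_zero]
  have hvar : Var[fun ω : PathSpace => ∑ t ∈ c.support, c t • ω t; W] =
      ‖rieszRep EnergySpace.toPath (c.sum fun t a => a • PathSpace.eval t)‖ ^ 2 := by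
    have hr : rieszRep EnergySpace.toPath (c.sum fun t a => a • PathSpace.eval t) =
        ∑ t ∈ c.support, c t • EnergySpace.kernel t := by
      rw [← rieszRepₗ_apply, Finsupp.sum, map_sum]
      simp [EnergySpace.rieszRep_eval]
    rw [← covariance_self hG.aemeasurable,
      covariance_fun_sum_fun_sum' (fun t _ => hm t) (fun t _ => hm t), hr,
      ← real_inner_self_eq_norm_sq, sum_inner]
    refine Finset.sum_congr rfl fun s _ => ?_
    rw [inner_sum]
    refine Finset.sum_congr rfl fun t _ => ?_
    rw [real_inner_smul_left, real_inner_smul_right, EnergySpace.inner_kernel,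
      EnergySpace.kernel_apply]
    simp only [smul_eq_mul]
    rw [covariance_const_mul_left, covariance_const_mul_right, covariance_eval hW, abs_sub_comm]
  rw [hc, hG.map_eq_gaussianReal, hmean, hvar]

theorem integral_exp_of_mem_span (hW : IsOrnsteinUhlenbeckLaw W) {y : StrongDual ℝ PathSpace}
    (hy : y ∈ Submodule.span ℝ (Set.range PathSpace.eval)) (t : ℝ) :
    ∫ ω, Complex.exp (t * y ω * Complex.I) ∂W =
      Complex.exp ((-(‖rieszRep EnergySpace.toPath y‖ ^ 2 * t ^ 2 / 2) : ℝ)) := by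
  have h := congrArg (fun μ => charFun μ t) (map_of_mem_span hW hy)
  rw [charFun_gaussianReal, charFun_apply_real,
    integral_map y.continuous.aemeasurable (by fun_prop)] at h
  rw [h, Real.coe_toNNReal _ (sq_nonneg _)]
  congr 1
  push_cast
  ring

/-- Pointwise convergence of finite combinations `y n` of evaluations forces `h_{y n}` to converge
in norm: the characteristic functions `exp (-‖h_{y n} - h_{y m}‖ ^ 2 / 2)` of the differences
tend to `1`. -/
theorem tendsto_rieszRep (hW : IsOrnsteinUhlenbeckLaw W) {x : StrongDual ℝ PathSpace}
    {y : ℕ → StrongDual ℝ PathSpace}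
    (hy : ∀ n, y n ∈ Submodule.span ℝ (Set.range PathSpace.eval))
    (hyx : ∀ ω, Tendsto (fun n => y n ω) atTop (𝓝 (x ω))) :
    Tendsto (fun n => rieszRep EnergySpace.toPath (y n)) atTop
      (𝓝 (rieszRep EnergySpace.toPath x)) := by
  have := (isGaussianProcess hW).isProbabilityMeasure
  have hint : Tendsto (fun p : ℕ × ℕ => ∫ ω, Complex.exp ((1 : ℝ) * (y p.1 - y p.2) ω * Complex.I) ∂W)
      atTop (𝓝 (∫ _, 1 ∂W)) := by
    refine tendsto_integral_filter_of_dominated_convergence (fun _ => 1)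
      (Eventually.of_forall fun p => ?_) (Eventually.of_forall fun p => ?_)
      (integrable_const _) (Eventually.of_forall fun ω => ?_)
    · have := (y p.1 - y p.2).continuous
      exact (by fun_prop : Continuous _).aestronglyMeasurable
    · refine Eventually.of_forall fun ω => ?_
      rw [← Complex.ofReal_mul, Complex.norm_exp_ofReal_mul_I]
    · have h1 : Tendsto (fun p : ℕ × ℕ => (y p.1 - y p.2) ω) atTop (𝓝 0) := by
        rw [← prod_atTop_atTop_eq]
        simpa using ((hyx ω).comp tendsto_fst).sub ((hyx ω).comp tendsto_snd)
      have h2 : Continuous fun r : ℝ => Complex.exp ((1 : ℝ) * r * Complex.I) := by fun_prop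
      simpa [Function.comp_def] using (h2.tendsto 0).comp h1
  have hnorm : Tendsto (fun p : ℕ × ℕ => Real.exp (-(‖rieszRep EnergySpace.toPath (y p.1) -
      rieszRep EnergySpace.toPath (y p.2)‖ ^ 2 / 2))) atTop (𝓝 1) := by
    have h := hint.norm
    simp only [integral_const, probReal_univ, one_smul, norm_one] at h
    refine h.congr fun p => ?_
    rw [integral_exp_of_mem_span hW (Submodule.sub_mem _ (hy _) (hy _)), ← Complex.ofReal_exp,
      Complex.norm_real, Real.norm_of_nonneg (Real.exp_pos _).le, ← rieszRepₗ_apply, map_sub]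
    simp
  have hsq : Tendsto (fun p : ℕ × ℕ => ‖rieszRep EnergySpace.toPath (y p.1) -
      rieszRep EnergySpace.toPath (y p.2)‖) atTop (𝓝 0) := by
    have h := ((hnorm.log one_ne_zero).const_mul (-2)).sqrt
    simp only [Real.log_exp, Real.log_one, mul_zero, Real.sqrt_zero] at h
    refine h.congr fun p => ?_
    rw [show ∀ a : ℝ, -2 * -(a ^ 2 / 2) = a ^ 2 from fun a => by ring,
      Real.sqrt_sq (norm_nonneg _)]
  have hcauchy : CauchySeq fun n => rieszRep EnergySpace.toPath (y n) := by
    rw [cauchySeq_iff_tendsto_dist_atTop_0]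
    simpa only [dist_eq_norm] using hsq
  obtain ⟨k, hk⟩ := cauchySeq_tendsto_of_complete hcauchy
  suffices h : k = rieszRep EnergySpace.toPath x by rwa [← h]
  refine ext_inner_left ℝ fun f => ?_
  have h1 : Tendsto (fun n => inner ℝ f (rieszRep EnergySpace.toPath (y n))) atTop
      (𝓝 (inner ℝ f k)) := tendsto_const_nhds.inner hk
  simp only [inner_rieszRep] at h1 ⊢
  exact tendsto_nhds_unique h1 (hyx _)

/-- Every `x ∈ 𝒰*` is a centred Gaussian variable under `W`, with variance `‖h_x‖ ^ 2`. -/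
theorem map_eq_gaussianReal (hW : IsOrnsteinUhlenbeckLaw W) (x : StrongDual ℝ PathSpace) :
    W.map x = gaussianReal 0 (‖rieszRep EnergySpace.toPath x‖ ^ 2).toNNReal := by
  have := (isGaussianProcess hW).isProbabilityMeasure
  have : IsProbabilityMeasure (W.map x) :=
    Measure.isProbabilityMeasure_map x.continuous.aemeasurable
  obtain ⟨y, hy, hyx⟩ := PathSpace.exists_tendsto_span_eval x
  refine Measure.ext_of_charFun (funext fun t => ?_)
  rw [charFun_apply_real, charFun_gaussianReal,
    integral_map x.continuous.aemeasurable (by fun_prop), Real.coe_toNNReal _ (sq_nonneg _)]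
  have h1 : Tendsto (fun n => ∫ ω, Complex.exp (t * y n ω * Complex.I) ∂W) atTop
      (𝓝 (∫ ω, Complex.exp (t * x ω * Complex.I) ∂W)) := by
    refine tendsto_integral_of_dominated_convergence (fun _ => 1) (fun n => ?_)
      (integrable_const _) (fun n => Eventually.of_forall fun ω => ?_)
      (Eventually.of_forall fun ω => ?_)
    · have := (y n).continuous
      exact (by fun_prop : Continuous _).aestronglyMeasurable
    · rw [← Complex.ofReal_mul, Complex.norm_exp_ofReal_mul_I]
    · have h2 : Continuous fun r : ℝ => Complex.exp (t * r * Complex.I) := by fun_prop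
      exact (h2.tendsto _).comp (hyx ω)
  simp only [integral_exp_of_mem_span hW (hy _)] at h1
  have h2 : Continuous fun h : EnergySpace =>
      Complex.exp ((-(‖h‖ ^ 2 * t ^ 2 / 2) : ℝ)) := by fun_prop
  rw [tendsto_nhds_unique h1 ((h2.tendsto _).comp (tendsto_rieszRep hW hy hyx))]
  congr 1
  push_cast
  ring

theorem memLp_dual (hW : IsOrnsteinUhlenbeckLaw W) (x : StrongDual ℝ PathSpace) :
    MemLp x 2 W := by
  have h : MemLp id 2 (W.map x) := by
    rw [map_eq_gaussianReal hW x]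
    exact memLp_id_gaussianReal 2
  exact h.comp_of_map x.continuous.aemeasurable

theorem integral_sq_dual (hW : IsOrnsteinUhlenbeckLaw W) (x : StrongDual ℝ PathSpace) :
    ∫ ω, x ω ^ 2 ∂W = ‖rieszRep EnergySpace.toPath x‖ ^ 2 := by
  have h1 : ∫ r : ℝ, r ^ 2 ∂(W.map x) = ‖rieszRep EnergySpace.toPath x‖ ^ 2 := by
    have h := variance_id_gaussianReal (μ := 0)
      (v := (‖rieszRep EnergySpace.toPath x‖ ^ 2).toNNReal)
    rw [variance_of_integral_eq_zero (by fun_prop) (by simp)] at h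
    rw [map_eq_gaussianReal hW x]
    simpa using h
  rw [← h1, integral_map x.continuous.aemeasurable (by fun_prop)]

/-! ### The Paley-Wiener map -/

/-- `x ↦ ⟨·, x⟩` as a linear map from `𝒰*` to `L²(W)`. -/
def dualL2 (hW : IsOrnsteinUhlenbeckLaw W) : StrongDual ℝ PathSpace →ₗ[ℝ] Lp ℝ 2 W where
  toFun x := (memLp_dual hW x).toLp x
  map_add' x y := MemLp.toLp_add (memLp_dual hW x) (memLp_dual hW y)
  map_smul' c x := MemLp.toLp_const_smul c (memLp_dual hW x)

theorem norm_dualL2 (hW : IsOrnsteinUhlenbeckLaw W) (x : StrongDual ℝ PathSpace) :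
    ‖dualL2 hW x‖ = ‖rieszRepₗ EnergySpace.toPath x‖ := by
  rw [← sq_eq_sq₀ (norm_nonneg _) (norm_nonneg _), rieszRepₗ_apply, ← integral_sq_dual hW,
    ← real_inner_self_eq_norm_sq, L2.inner_def]
  refine integral_congr_ae ?_
  filter_upwards [(memLp_dual hW x).coeFn_toLp] with ω hω
  change inner ℝ ((memLp_dual hW x).toLp x ω) ((memLp_dual hW x).toLp x ω) = _
  rw [hω, real_inner_self_eq_norm_sq, Real.norm_eq_abs, sq_abs]

/-- The Paley-Wiener map `𝓘 : H^U → L²(W)`, the continuous extension of `h_x ↦ ⟨·, x⟩`. -/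
def paleyWiener (hW : IsOrnsteinUhlenbeckLaw W) : EnergySpace →L[ℝ] Lp ℝ 2 W :=
  (dualL2 hW).extendOfNorm (rieszRepₗ EnergySpace.toPath)

theorem paleyWiener_rieszRep (hW : IsOrnsteinUhlenbeckLaw W) (x : StrongDual ℝ PathSpace) :
    paleyWiener hW (rieszRep EnergySpace.toPath x) = dualL2 hW x :=
  (dualL2 hW).extendOfNorm_eq denseRange_rieszRepₗ
    ⟨1, fun x => by rw [one_mul, norm_dualL2]⟩ x

theorem isPaleyWiener_iff (hW : IsOrnsteinUhlenbeckLaw W) (h : EnergySpace) (Y : PathSpace → ℝ) :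
    IsPaleyWiener EnergySpace.toPath W h Y ↔
      ∃ hY : MemLp Y 2 W, hY.toLp Y = paleyWiener hW h := by
  have key : ∀ (hY : MemLp Y 2 W) (x : ℕ → StrongDual ℝ PathSpace),
      Tendsto (fun n => dualL2 hW (x n)) atTop (𝓝 (hY.toLp Y)) ↔
      Tendsto (fun n => eLpNorm (fun ω => x n ω - Y ω) 2 W) atTop (𝓝 0) := fun hY x =>
    Lp.tendsto_Lp_iff_tendsto_eLpNorm'' (fun n ω => x n ω) (fun n => memLp_dual hW (x n)) Y hY
  constructor
  · rintro ⟨hY, x, hx, hx'⟩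
    refine ⟨hY, tendsto_nhds_unique ((key hY x).2 hx') ?_⟩
    simp only [← paleyWiener_rieszRep]
    exact ((paleyWiener hW).continuous.tendsto h).comp hx
  · rintro ⟨hY, hYh⟩
    obtain ⟨k, hk, hkh⟩ := mem_closure_iff_seq_limit.1 (denseRange_rieszRepₗ h)
    choose x hx using hk
    have hx' : Tendsto (fun n => rieszRep EnergySpace.toPath (x n)) atTop (𝓝 h) :=
      hkh.congr fun n => (hx n).symm
    refine ⟨hY, x, hx', (key hY x).1 ?_⟩
    rw [hYh]
    simp only [← paleyWiener_rieszRep]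
    exact ((paleyWiener hW).continuous.tendsto h).comp hx'

theorem continuous_integral_exp [IsProbabilityMeasure W] :
    Continuous fun Y : Lp ℝ 2 W => ∫ ω, Complex.exp (Y ω * Complex.I) ∂W := by
  have hi : ∀ Y : Lp ℝ 2 W, Integrable (fun ω => Complex.exp (Y ω * Complex.I)) W := fun Y => by
    refine (integrable_const (1 : ℝ)).mono' ?_ (Eventually.of_forall fun ω => ?_)
    · exact (by fun_prop : Continuous fun r : ℝ => Complex.exp (r * Complex.I))
        |>.comp_aestronglyMeasurable (Lp.aestronglyMeasurable Y)
    · rw [Complex.norm_exp_ofReal_mul_I]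
  refine (LipschitzWith.of_dist_le_mul (K := 1) fun Y Z => ?_).continuous
  rw [dist_eq_norm, dist_eq_norm, ← integral_sub (hi Y) (hi Z), NNReal.coe_one, one_mul]
  have hle : ∀ a b : ℝ, ‖Complex.exp (a * Complex.I) - Complex.exp (b * Complex.I)‖ ≤ ‖a - b‖ := by
    intro a b
    have h : Complex.exp (a * Complex.I) - Complex.exp (b * Complex.I) =
        Complex.exp (b * Complex.I) * (Complex.exp (Complex.I * ((a - b : ℝ) : ℂ)) - 1) := by
      rw [mul_sub, ← Complex.exp_add, mul_one]
      push_cast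
      ring_nf
    rw [h, norm_mul, Complex.norm_exp_ofReal_mul_I, one_mul]
    exact Real.norm_exp_I_mul_ofReal_sub_one_le
  have hm : MemLp (Y - Z : Lp ℝ 2 W) 1 W := (Lp.memLp (Y - Z)).mono_exponent one_le_two
  refine (norm_integral_le_integral_norm _).trans ?_
  have h1 : ∫ ω, ‖(Y - Z : Lp ℝ 2 W) ω‖ ∂W ≤ ‖Y - Z‖ := by
    rw [integral_norm_eq_lintegral_enorm hm.1, ← eLpNorm_one_eq_lintegral_enorm, Lp.norm_def]
    exact ENNReal.toReal_mono (Lp.eLpNorm_ne_top _)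
      (eLpNorm_le_eLpNorm_of_exponent_le one_le_two hm.1)
  refine le_trans (integral_mono_ae ((hi Y).sub (hi Z)).norm
    (memLp_one_iff_integrable.1 hm).norm ?_) h1
  filter_upwards [Lp.coeFn_sub Y Z] with ω hω
  rw [hω]
  exact hle _ _

/-- `𝓘(h)` is a centred Gaussian variable with variance `‖h‖ ^ 2`. -/
theorem integral_exp_paleyWiener (hW : IsOrnsteinUhlenbeckLaw W) (h : EnergySpace) :
    ∫ ω, Complex.exp (paleyWiener hW h ω * Complex.I) ∂W =
      Complex.exp ((-(‖h‖ ^ 2 / 2) : ℝ)) := by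
  have := (isGaussianProcess hW).isProbabilityMeasure
  refine denseRange_rieszRepₗ.induction_on h (isClosed_eq
    (continuous_integral_exp.comp (paleyWiener hW).continuous) (by fun_prop)) fun x => ?_
  have h1 := congrArg (fun μ => charFun μ 1) (map_eq_gaussianReal hW x)
  rw [charFun_gaussianReal, charFun_apply_real,
    integral_map x.continuous.aemeasurable (by fun_prop), Real.coe_toNNReal _ (sq_nonneg _)] at h1
  rw [rieszRepₗ_apply, paleyWiener_rieszRep]
  have h2 : ∫ ω, Complex.exp (dualL2 hW x ω * Complex.I) ∂W =
      ∫ ω, Complex.exp ((1 : ℝ) * x ω * Complex.I) ∂W := by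
    refine integral_congr_ae ?_
    filter_upwards [(memLp_dual hW x).coeFn_toLp] with ω hω
    change Complex.exp ((memLp_dual hW x).toLp x ω * Complex.I) = _
    rw [hω, Complex.ofReal_one, one_mul]
  rw [h2, h1]
  congr 1
  push_cast
  ring

/-! ### Existence of the associated map -/

/-- A linear isometry of `H^U` does not change the joint law of a family of Paley-Wiener
variables: the characteristic functions of the finite-dimensional laws depend only on norms. -/
theorem map_paleyWiener_isometry (hW : IsOrnsteinUhlenbeckLaw W) {ι : Type*}
    (A : EnergySpace →ₗᵢ[ℝ] EnergySpace) (h : ι → EnergySpace) :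
    W.map (fun ω i => paleyWiener hW (A (h i)) ω) = W.map (fun ω i => paleyWiener hW (h i) ω) := by
  classical
  have := (isGaussianProcess hW).isProbabilityMeasure
  have hmeas : ∀ k : EnergySpace, Measurable (paleyWiener hW k : PathSpace → ℝ) := fun k =>
    (Lp.stronglyMeasurable _).measurable
  have hm : ∀ k : ι → EnergySpace, Measurable fun ω i => paleyWiener hW (k i) ω := fun k =>
    measurable_pi_lambda _ fun i => hmeas _
  have hchar : ∀ (I : Finset ι) (k : ι → EnergySpace) (L : StrongDual ℝ (I → ℝ)),
      charFunDual (W.map fun ω (i : I) => paleyWiener hW (k i) ω) L =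
        Complex.exp ((-(‖∑ i : I, L (Pi.single i 1) • k i‖ ^ 2 / 2) : ℝ)) := by
    intro I k L
    rw [charFunDual_apply, integral_map (measurable_pi_lambda _ fun i => hmeas _).aemeasurable
      (by fun_prop), ← integral_exp_paleyWiener hW]
    refine integral_congr_ae ?_
    have hsum : ∀ᵐ ω ∂W, paleyWiener hW (∑ i : I, L (Pi.single i 1) • k i) ω =
        ∑ i : I, L (Pi.single i 1) * paleyWiener hW (k i) ω := by
      have hs : ∀ᵐ ω ∂W, ∀ i : I, (L (Pi.single i 1) • paleyWiener hW (k i) : Lp ℝ 2 W) ω =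
          L (Pi.single i 1) * paleyWiener hW (k i) ω :=
        ae_all_iff.2 fun i => Lp.coeFn_smul _ _
      rw [map_sum]
      simp only [map_smul]
      filter_upwards [Lp.coeFn_finsetSum Finset.univ
        fun i : I => L (Pi.single i 1) • paleyWiener hW (k i), hs] with ω h1 h2
      rw [h1, Finset.sum_apply]
      exact Finset.sum_congr rfl fun i _ => h2 i
    filter_upwards [hsum] with ω hω
    rw [hω]
    congr 3
    rw [← ContinuousLinearMap.coe_coe, LinearMap.pi_apply_eq_sum_univ]
    refine Finset.sum_congr rfl fun i _ => ?_
    rw [smul_eq_mul, mul_comm]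
    congr 2
    ext j
    simp [Pi.single_apply, eq_comm]
  have hproj : ∀ k : ι → EnergySpace, IsProjectiveLimit
      (W.map fun ω i => paleyWiener hW (k i) ω)
      (fun I : Finset ι => W.map fun ω (i : I) => paleyWiener hW (k i) ω) := by
    intro k I
    rw [Measure.map_map (Finset.measurable_restrict I) (hm k)]
    rfl
  have hfin : ∀ (k : ι → EnergySpace) (I : Finset ι),
      IsProbabilityMeasure (W.map fun ω (i : I) => paleyWiener hW (k i) ω) := fun k I =>
    Measure.isProbabilityMeasure_map (measurable_pi_lambda _ fun i => hmeas _).aemeasurable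
  refine IsProjectiveLimit.unique (hproj _) ?_
  have heq : (fun I : Finset ι => W.map fun ω (i : I) => paleyWiener hW (A (h i)) ω) =
      fun I : Finset ι => W.map fun ω (i : I) => paleyWiener hW (h i) ω := by
    funext I
    have := hfin h I
    have := hfin (A ∘ h) I
    refine Measure.ext_of_charFunDual (funext fun L => ?_)
    rw [hchar I (fun i => A (h i)), hchar I h, 
      ← A.norm_map (∑ i : I, L (Pi.single i 1) • h i), map_sum]
    simp only [map_smul]
  rw [heq]
  exact hproj h

theorem paleyWiener_kernel_ae_eq (hW : IsOrnsteinUhlenbeckLaw W) (t : ℝ) :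
    paleyWiener hW (EnergySpace.kernel t) =ᵐ[W] fun ω => ω t := by
  rw [← EnergySpace.rieszRep_eval, paleyWiener_rieszRep]
  exact (memLp_dual hW (PathSpace.eval t)).coeFn_toLp

/-- For every isometry `A` there is a measure preserving map `T` of the path space whose value at
each rational time `q` is `𝓘(A k_q)`, where `k_q` is the reproducing kernel. These variables have
the law of the values at rational times of the path itself, so that almost surely they are the
values of a unique path. -/
theorem exists_measurePreserving (hW : IsOrnsteinUhlenbeckLaw W)
    (A : EnergySpace →ₗᵢ[ℝ] EnergySpace) : ∃ T : PathSpace → PathSpace,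
      MeasurePreserving T W W ∧
      ∀ᵐ ω ∂W, ∀ q : ℚ, T ω q = paleyWiener hW (A (EnergySpace.kernel q)) ω := by
  set r : PathSpace → ℚ → ℝ := fun ω q => ω (q : ℝ) with hr
  set X : PathSpace → ℚ → ℝ := fun ω q => paleyWiener hW (A (EnergySpace.kernel q)) ω with hX
  have hrm : MeasurableEmbedding r := PathSpace.measurableEmbedding_restrict
  have hXm : Measurable X :=
    measurable_pi_lambda _ fun q => (Lp.stronglyMeasurable _).measurable
  have hlaw : W.map X = W.map r := by
    rw [hX, map_paleyWiener_isometry hW A fun q : ℚ => EnergySpace.kernel q]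
    refine Measure.map_congr ?_
    have h : ∀ᵐ ω ∂W, ∀ q : ℚ, paleyWiener hW (EnergySpace.kernel q) ω = ω (q : ℝ) :=
      ae_all_iff.2 fun q => paleyWiener_kernel_ae_eq hW q
    filter_upwards [h] with ω hω
    exact funext hω
  obtain ⟨g, hg, hgr⟩ := hrm.exists_measurable_extend measurable_id fun _ => ⟨(0 : PathSpace)⟩
  refine ⟨g ∘ X, ⟨hg.comp hXm, ?_⟩, ?_⟩
  · rw [← Measure.map_map hg hXm, hlaw, Measure.map_map hg hrm.measurable, hgr, Measure.map_id]
  · have hrange : ∀ᵐ ω ∂W, X ω ∈ Set.range r := by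
      refine (ae_map_iff hXm.aemeasurable hrm.measurableSet_range).1 ?_
      rw [hlaw, ae_map_iff hrm.measurable.aemeasurable hrm.measurableSet_range]
      exact Eventually.of_forall fun ω => ⟨ω, rfl⟩
    filter_upwards [hrange] with ω ⟨η, hη⟩ q
    have h1 : g (X ω) = η := by
      rw [← hη]
      exact congrFun hgr η
    rw [Function.comp_apply, h1]
    exact congrFun hη q

theorem exists_isAssociatedMap (hW : IsOrnsteinUhlenbeckLaw W) (O : EnergySpace ≃ₗᵢ[ℝ] EnergySpace) :
    ∃ T, IsAssociatedMap EnergySpace.toPath W O T := by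
  obtain ⟨T, hT, hTq⟩ := exists_measurePreserving hW O.symm.toLinearIsometry
  refine ⟨T, hT.measurable.aemeasurable, fun h Y Z hY hZ => ?_⟩
  obtain ⟨hY', hYh⟩ := (isPaleyWiener_iff hW _ _).1 hY
  obtain ⟨hZ', hZh⟩ := (isPaleyWiener_iff hW _ _).1 hZ
  have key : (Lp.compMeasurePreservingₗᵢ ℝ T hT).toContinuousLinearMap ∘L paleyWiener hW =
      paleyWiener hW ∘L (O.symm.toContinuousLinearEquiv : EnergySpace →L[ℝ] EnergySpace) := by
    refine ContinuousLinearMap.ext_on EnergySpace.dense_span_kernel ?_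
    rintro _ ⟨q, rfl⟩
    refine Lp.ext ?_
    have h1 := Lp.coeFn_compMeasurePreserving (paleyWiener hW (EnergySpace.kernel q)) hT
    have h2 := hT.quasiMeasurePreserving.ae_eq_comp (paleyWiener_kernel_ae_eq hW q)
    filter_upwards [h1, h2, hTq] with ω h1 h2 h3
    refine h1.trans (h2.trans ?_)
    exact h3 q
  have hk := DFunLike.congr_fun key h
  have h1 := Lp.coeFn_compMeasurePreserving (paleyWiener hW h) hT
  have h2 := hT.quasiMeasurePreserving.ae_eq_comp (hYh ▸ hY'.coeFn_toLp)
  have h3 : paleyWiener hW (O.symm h) =ᵐ[W] Z := hZh ▸ hZ'.coeFn_toLp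
  have h4 : Lp.compMeasurePreserving T hT (paleyWiener hW h) = paleyWiener hW (O.symm h) := hk
  rw [h4] at h1
  exact h2.symm.trans (h1.symm.trans h3)

/-! ### The associated map is the convolution -/

theorem isPaleyWiener_dual (hW : IsOrnsteinUhlenbeckLaw W) (x : StrongDual ℝ PathSpace) :
    IsPaleyWiener EnergySpace.toPath W (rieszRep EnergySpace.toPath x) x :=
  (isPaleyWiener_iff hW _ _).2 ⟨memLp_dual hW x, (paleyWiener_rieszRep hW x).symm⟩

/-- For a fixed real `φ` both sides, tested against `φ`, are versions of the same Paley-Wiener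
variable. Separability of the Schwartz space makes the exceptional set independent of `φ`. -/
theorem distConv_ae_eq (hW : IsOrnsteinUhlenbeckLaw W) {u : ℝ} {S : PathSpace → PathSpace}
    (hS : IsAssociatedMap EnergySpace.toPath W (orthFlow u) S) :
    ∀ᵐ ω ∂W, distConv u ω.toDistribution = (S ω).toDistribution := by
  have hφ : ∀ φ : 𝓢(ℝ, ℝ), ∀ᵐ ω ∂W,
      PathSpace.pairing φ (S ω) = PathSpace.pairing (realConv (-u) φ) ω := fun φ =>
    hS.comp_ae_eq _ _ _ (isPaleyWiener_dual hW _) <| by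
      rw [orthFlow_symm_rieszRep_pairing]
      exact isPaleyWiener_dual hW _
  have hall := ae_all_iff.2 fun n => hφ (TopologicalSpace.denseSeq 𝓢(ℝ, ℝ) n)
  filter_upwards [hall] with ω hω
  have hreal : ∀ φ : 𝓢(ℝ, ℝ), distConv u ω.toDistribution (φ.postcompCLM Complex.ofRealCLM) =
      (S ω).toDistribution (φ.postcompCLM Complex.ofRealCLM) := by
    have hc : ∀ T : 𝓢'(ℝ, ℂ), Continuous fun φ : 𝓢(ℝ, ℝ) =>
        T (φ.postcompCLM Complex.ofRealCLM) := fun T =>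
      T.continuous.comp (SchwartzMap.postcompCLM Complex.ofRealCLM).continuous
    refine congrFun ((TopologicalSpace.denseRange_denseSeq 𝓢(ℝ, ℝ)).equalizer (hc _) (hc _) ?_)
    funext n
    simp only [Function.comp_apply]
    rw [PathSpace.distConv_toDistribution_ofReal, PathSpace.toDistribution_ofReal, hω n]
  ext φ
  have hsplit : φ = (φ.postcompCLM Complex.reCLM : 𝓢(ℝ, ℝ)).postcompCLM Complex.ofRealCLM +
      Complex.I • (φ.postcompCLM Complex.imCLM : 𝓢(ℝ, ℝ)).postcompCLM Complex.ofRealCLM := by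
    ext t
    simpa [mul_comm] using (Complex.re_add_im (φ t)).symm
  rw [hsplit, map_add, map_add, map_smul, map_smul, hreal, hreal]

end IsOrnsteinUhlenbeckLaw

end OUFlow

end

theorem proposition2 (W : Measure PathSpace) (hW : IsOrnsteinUhlenbeckLaw W) (u : ℝ) :
    (∀ᵐ ω ∂W, ∃ η : PathSpace, distConv u ω.toDistribution = η.toDistribution) ∧
    (∃ S : PathSpace → PathSpace, IsAssociatedMap EnergySpace.toPath W (orthFlow u) S) ∧
    (∀ S : PathSpace → PathSpace, IsAssociatedMap EnergySpace.toPath W (orthFlow u) S →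
      ∀ᵐ ω ∂W, distConv u ω.toDistribution = (S ω).toDistribution) := by
  obtain ⟨S, hS⟩ := hW.exists_isAssociatedMap (orthFlow u)
  refine ⟨?_, ⟨S, hS⟩, fun T hT => hW.distConv_ae_eq hT⟩
  filter_upwards [hW.distConv_ae_eq hS] with ω hω
  exact ⟨S ω, hω⟩
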